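/- **Setting.** Let $k$ be an algebraically closed field. A partition is identified with its Young diagram (English notation); $\mu'$ denotes the transpose of $\mu$. Let $\alpha$, $\beta$, $\gamma$ be partitions with $\gamma\subseteq\beta$. The skew diagram $\beta\setminus\gamma$ is a *vertical strip* if $\beta_i\le\gamma_i+1$ for all $i$, a *horizontal strip* if $\beta'\setminus\gamma'$ is a vertical strip, and a *rook strip* if it is both. An *LR-tableau of type* $(\alpha,\beta,\gamma)$ is a filling of $\beta\setminus\gamma$ with exactly $\alpha_u$ entries $u$ for each $u\ge1$, with weakly increasing rows and strictly increasing columns, and such that for each $u>1$ and each column $c$, the number of entries $u-1$ to the right of $c$ is at least the number of entries $u$ to the right of $c$. For such a tableau $X$ let $\gamma^{(i)}(X)$ be the partition whose diagram consists of $\gamma$ and the boxes with entries $1,\dots,i$. **The three relations** on the set of LR-tableaux of type $(\alpha,\beta,\gamma)$. * *Dominance.* $Z\le_{\sf dom}X$ if for all $i$ and $j$ one has $\sum_{r\le j}\gamma^{(i)}(Z)_r\le\sum_{r\le j}\gamma^{(i)}(X)_r$. * *Box.* $Z$ is obtained from $X$ by a *decreasing box move* if two entries of $X$ are exchanged so that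 afterwards the smaller entry is in the lower position, and $Z$ results by re-sorting the entries in each row and in each column if necessary. $Z\le_{\sf box}X$ means that $Z$ is obtained from $X$ by a finite (possibly empty) sequence of decreasing box moves through LR-tableaux of type $(\alpha,\beta,\gamma)$. * *Boundary.* For a partition $\mu$ let $N_\mu$ be the nilpotent $k$-linear operator with Jordan blocks of sizes $\mu_1,\mu_2,\dots$. For an LR-tableau $X$ of type $(\alpha,\beta,\gamma)$ let $\mathbb V_X\subseteq\operatorname{Hom}_k(N_{\alpha'},N_{\beta'})$ be the set of all monomorphisms of nilpotent operators $N_{\alpha'}\to N_{\beta'}$ with cokernel isomorphic to $N_{\gamma'}$ such that, for $B=N_{\beta'}$ with operator $T$ and $A\subseteq B$ the image, $B/T^\ell A\cong N_{\gamma^{(\ell)}(X)'}$ for all $\ell\ge0$. Write $Z\preccurlyeq_{\sf boundary}X$ if $\mathbb V_X\cap\overline{\mathbb V_Z}\ne\emptyset$, where the bar denotes the Zariski closure in the affine space $\operatorname{Hom}_k(N_{\alpha'},N_{\beta'})$, and let $\le_{\sf boundary}$ be the transitive closure of $\preccurlyeq_{\sf boundary}$ on the set of LR-tableaux of type $(\alpha,\beta,\gamma)$.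 **Theorem.** Let $X$ and $Z$ be LR-tableaux of the same type $(\alpha,\beta,\gamma)$ such that $\beta\setminus\gamma$ is a rook strip. Then the following statements are equivalent: 1. $Z\le_{\sf box}X$; 2. $Z\le_{\sf boundary}X$; 3. $Z\le_{\sf dom}X$. -/

import Mathlib

/-! Partitions are Young diagrams `μ : YoungDiagram` in English notation: `(i, j) ∈ μ` is the box in
row `i` and column `j` (both counted from `0`), and the parts of the partition are `μ.rowLen i`. -/

namespace LRTab

/-- The boxes of the skew diagram `β \ γ`. -/
abbrev SkewCell (β γ : YoungDiagram) : Type := {p : ℕ × ℕ // p ∈ β.cells \ γ.cells}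

/-- `β \ γ` is a vertical strip. -/
def IsVerticalStrip (β γ : YoungDiagram) : Prop := ∀ i, β.rowLen i ≤ γ.rowLen i + 1

/-- `β \ γ` is a horizontal strip. -/
def IsHorizontalStrip (β γ : YoungDiagram) : Prop := IsVerticalStrip β.transpose γ.transpose

/-- `β \ γ` is a rook strip. -/
def IsRookStrip (β γ : YoungDiagram) : Prop := IsHorizontalStrip β γ ∧ IsVerticalStrip β γ

/-- Littlewood-Richardson tableaux of type `(α, β, γ)`, i.e. of shape `β \ γ` and content `α`. -/
@[ext]
structure LRTableau (α β γ : YoungDiagram) where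
  /-- the diagram of `γ` is contained in the diagram of `β` -/
  contained : γ ≤ β
  /-- the entry in each box -/
  entry : SkewCell β γ → ℕ
  entry_pos : ∀ p, 1 ≤ entry p
  /-- the entry `u + 1` occurs exactly `α_{u+1}` times -/
  content : ∀ u : ℕ, {p | entry p = u + 1}.ncard = α.rowLen u
  row_weak : ∀ p q : SkewCell β γ, p.1.1 = q.1.1 → p.1.2 < q.1.2 → entry p ≤ entry q
  col_strict : ∀ p q : SkewCell β γ, p.1.2 = q.1.2 → p.1.1 < q.1.1 → entry p < entry q
  /-- lattice permutation property: on the right hand side of each column `c`, the number of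
  entries `u` is at most the number of entries `u - 1` -/
  lattice : ∀ u : ℕ, 1 < u → ∀ c : ℕ,
    {p | c < p.1.2 ∧ entry p = u}.ncard ≤ {p | c < p.1.2 ∧ entry p = u - 1}.ncard

variable {α β γ : YoungDiagram}

/-- The partition `γ^{(i)}`: the region of `β` formed by `γ` and the boxes with entries
`1, …, i`. -/
def LRTableau.region (X : LRTableau α β γ) (i : ℕ) : YoungDiagram where
  cells := γ.cells ∪ ({p | X.entry p ≤ i} : Finset (SkewCell β γ)).map (Function.Embedding.subtype _)
  isLowerSet := by
    rintro ⟨c, d⟩ ⟨a, b⟩ hle h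
    obtain ⟨h1, h2⟩ : a ≤ c ∧ b ≤ d := hle
    by_cases hγ : (a, b) ∈ γ.cells
    · simp [hγ]
    simp only [Finset.coe_union, Set.mem_union, Finset.mem_coe, Finset.mem_map,
      Finset.mem_filter, Finset.mem_univ, true_and] at h ⊢
    right
    rcases h with h | ⟨p, hp, hpe⟩
    · exact absurd (γ.isLowerSet (Prod.mk_le_mk.2 ⟨h1, h2⟩) h) hγ
    have hpe' : p.1 = (c, d) := hpe
    obtain ⟨⟨c', d'⟩, hm⟩ := p
    obtain ⟨rfl, rfl⟩ : c' = c ∧ d' = d := Prod.mk.inj hpe'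
    have hβ : (c', d') ∈ β.cells := (Finset.mem_sdiff.1 hm).1
    have hm1 : (a, d') ∈ β.cells \ γ.cells := Finset.mem_sdiff.2
      ⟨β.isLowerSet (Prod.mk_le_mk.2 ⟨h1, le_rfl⟩) hβ,
        fun h => hγ (γ.isLowerSet (Prod.mk_le_mk.2 ⟨le_rfl, h2⟩) h)⟩
    have hm2 : (a, b) ∈ β.cells \ γ.cells := Finset.mem_sdiff.2
      ⟨β.isLowerSet (Prod.mk_le_mk.2 ⟨h1, h2⟩) hβ, hγ⟩
    refine ⟨⟨(a, b), hm2⟩, ?_, rfl⟩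
    have e1 : X.entry ⟨(a, b), hm2⟩ ≤ X.entry ⟨(a, d'), hm1⟩ := by
      rcases h2.eq_or_lt with rfl | h
      · exact le_rfl
      · exact X.row_weak _ _ rfl h
    have e2 : X.entry ⟨(a, d'), hm1⟩ ≤ X.entry ⟨(c', d'), hm⟩ := by
      rcases h1.eq_or_lt with rfl | h
      · exact le_rfl
      · exact (X.col_strict ⟨(a, d'), hm1⟩ ⟨(c', d'), hm⟩ rfl h).le
    exact (e1.trans e2).trans hp

/-! ### The dominance order -/

/-- The dominance order on partitions. -/
def PartDomLE (μ ν : YoungDiagram) : Prop :=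
  ∀ j : ℕ, ∑ i ∈ Finset.range j, μ.rowLen i ≤ ∑ i ∈ Finset.range j, ν.rowLen i

/-- `DomLE Z X` is `Z ≤_dom X`. -/
def DomLE (Z X : LRTableau α β γ) : Prop := ∀ i : ℕ, PartDomLE (Z.region i) (X.region i)

/-! ### The box order -/

/-- `Z` is obtained from `X` by a decreasing box move: the entries in two boxes `a` and `b` of `X`,
with the smaller one in the higher box `a`, are exchanged, and the result is re-sorted
within rows (by `r`) and within columns (by `c`). -/
def BoxMove (X Z : LRTableau α β γ) : Prop :=
  ∃ a b : SkewCell β γ, X.entry a < X.entry b ∧ a.1.1 < b.1.1 ∧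
    ∃ r c : Equiv.Perm (SkewCell β γ),
      (∀ p, (r p).1.1 = p.1.1) ∧ (∀ p, (c p).1.2 = p.1.2) ∧
      ∀ p, Z.entry p = X.entry (Equiv.swap a b (r (c p)))

/-- `BoxLE Z X` is `Z ≤_box X`: `Z` is obtained from `X` by finitely many (possibly no)
decreasing box moves, through LR-tableaux of the same type. -/
def BoxLE (Z X : LRTableau α β γ) : Prop := Relation.ReflTransGen BoxMove X Z

/-! ### Nilpotent operators and the boundary relation -/

/-- The underlying vector space of the nilpotent operator `N_μ`; its standard basis is
indexed by the boxes of `μ`. -/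
abbrev NilSpace (k : Type*) (μ : YoungDiagram) : Type _ := μ.cells → k

/-- The nilpotent operator `T` of `N_μ`, with one Jordan block for each row of `μ`, of size the
length of the row: `T e_{(i, j + 1)} = e_{(i, j)}` and `T e_{(i, 0)} = 0`. -/
def nilOp (k : Type*) [Field k] (μ : YoungDiagram) : Module.End k (NilSpace k μ) where
  toFun v p := if h : (p.1.1, p.1.2 + 1) ∈ μ.cells then v ⟨(p.1.1, p.1.2 + 1), h⟩ else 0
  map_add' v w := by
    funext p
    by_cases h : (p.1.1, p.1.2 + 1) ∈ μ.cells <;>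
      simp only [h, dite_true, dite_false, Pi.add_apply, add_zero]
  map_smul' c v := by
    funext p
    by_cases h : (p.1.1, p.1.2 + 1) ∈ μ.cells <;>
      simp only [h, dite_true, dite_false, Pi.smul_apply, smul_zero, RingHom.id_apply]

/-- The factor `N_μ / W`, with the action induced by `T`, is isomorphic to `N_ν` (in particular,
`W` is `T`-invariant). -/
def QuotientIso (k : Type*) [Field k] (μ : YoungDiagram) (W : Submodule k (NilSpace k μ))
    (ν : YoungDiagram) : Prop :=
  ∃ e : (NilSpace k μ ⧸ W) ≃ₗ[k] NilSpace k ν,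
    ∀ v, e (W.mkQ (nilOp k μ v)) = nilOp k ν (e (W.mkQ v))

/-- The set `𝕍_{α,γ}^β` of monomorphisms of nilpotent operators `N_α → N_β` with
cokernel isomorphic to `N_γ`, as a subset of `Hom_k(N_α, N_β)`. -/
def embeddings (k : Type*) [Field k] (α β γ : YoungDiagram) :
    Set (NilSpace k α →ₗ[k] NilSpace k β) :=
  {φ | φ ∘ₗ nilOp k α = nilOp k β ∘ₗ φ ∧ Function.Injective φ ∧
    QuotientIso k β (LinearMap.range φ) γ}

/-- For `X` of type `(α, β, γ)`, the stratum `𝕍_X` of those embeddings in `𝕍_{α',γ'}^{β'}` that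
have tableau `X`: for the image `A` of the embedding in `B = N_{β'}`, each factor `B / T^ℓ A` is
isomorphic to `N_ν` where `ν` is the transpose of the partition `γ^{(ℓ)}` of `X`. -/
def stratum (k : Type*) [Field k] (X : LRTableau α β γ) :
    Set (NilSpace k α.transpose →ₗ[k] NilSpace k β.transpose) :=
  {φ | φ ∈ embeddings k α.transpose β.transpose γ.transpose ∧
    ∀ l : ℕ, QuotientIso k β.transpose
      ((LinearMap.range φ).map (nilOp k β.transpose ^ l)) (X.region l).transpose}

/-- The coordinates (matrix entries) on the affine space `Hom_k(N_μ, N_ν)`. -/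
def coords (k : Type*) [Field k] {μ ν : YoungDiagram} (φ : NilSpace k μ →ₗ[k] NilSpace k ν) :
    ν.cells × μ.cells → k :=
  fun p => LinearMap.toMatrix' φ p.1 p.2

/-- The Zariski closure of a subset of the affine space `Hom_k(N_μ, N_ν)`. -/
def zariskiClosure (k : Type*) [Field k] {μ ν : YoungDiagram}
    (S : Set (NilSpace k μ →ₗ[k] NilSpace k ν)) : Set (NilSpace k μ →ₗ[k] NilSpace k ν) :=
  {φ | coords k φ ∈
    MvPolynomial.zeroLocus k (MvPolynomial.vanishingIdeal k (coords k '' S))}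

/-- `BoundaryRel k Z X` is the boundary relation `Z ≼_boundary X`. -/
def BoundaryRel (k : Type*) [Field k] (Z X : LRTableau α β γ) : Prop :=
  (stratum k X ∩ zariskiClosure k (stratum k Z)).Nonempty

/-- `BoundaryLE k Z X` is `Z ≤_boundary X`: the transitive closure of the boundary relation
on the LR-tableaux of the same type. -/
def BoundaryLE (k : Type*) [Field k] (Z X : LRTableau α β γ) : Prop :=
  Relation.TransGen (BoundaryRel k) Z X

end LRTab

/-! On a rook strip each row and each column holds at most one box, and lower boxes lie further
left. A tableau is thus a word read from top to bottom: re-sorting does nothing, the lattice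
condition is the usual one for prefixes, and dominance compares, for all `i` and `j`, the number of
letters at most `i` in the first `j` rows. A decreasing box move exchanges two letters and lowers
the word, so 1 implies 3.

For 2 implies 3, write `B` for the target and `A` for the image of `φ`. The codimension of `T^j B +
T^l A` in `B` is the sum of the first `j` parts of `γ^(l)` (`finrank_range_pow_sup`), and its
dimension is the rank of a matrix depending polynomially on `φ`, hence lower semicontinuous
(`exists_finrank_range_powSum_le`).

The converses rest on `exists_swap_of_wordDomLE`: a lattice word strictly above `z` admits a
decreasing exchange that keeps it lattice and above `z`, with neither exchanged letter occurring in
between. Iterating gives 3 implies 1. For 3 implies 2, each such exchange is realised by a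
degeneration. The boxes with the same rank among equal entries form a descending chain, a pole, one
for each column of `α`; the sum of the poles is an explicit embedding with tableau `X`. Adding to
the pole through `b` the term `t` in the column of `a` gives a line of homomorphisms that have
tableau `Z` for `t ≠ 0` and tableau `X` at `t = 0`. Tableaux of explicit maps are identified by
`mem_stratum_of_exists`, which combines triangular generators with a dimension count. -/

namespace LRTab

/-! ### Lattice words and their dominance order. -/

section Words

variable {ι : Type*} [Fintype ι] (r : ι → ℕ)

/-- The number of letters of the word `x` satisfying `P` at positions before `j`; the position of
the letter with index `q` is `r q`. -/
def wordCount (x : ι → ℕ) (P : ℕ → Prop) [DecidablePred P] (j : ℕ) : ℕ :=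
  (Finset.univ.filter fun q => r q < j ∧ P (x q)).card

/-- Lattice words. -/
def IsLatticeWord (x : ι → ℕ) : Prop :=
  ∀ u, 1 ≤ u → ∀ j, wordCount r x (· = u + 1) j ≤ wordCount r x (· = u) j

/-- Dominance order on words. -/
def WordDomLE (z x : ι → ℕ) : Prop :=
  ∀ i j, wordCount r z (· ≤ i) j ≤ wordCount r x (· ≤ i) j

variable {r}

lemma wordCount_mono (x : ι → ℕ) (P : ℕ → Prop) [DecidablePred P] {i j : ℕ} (h : i ≤ j) :
    wordCount r x P i ≤ wordCount r x P j :=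
  Finset.card_le_card fun q hq => by
    simp only [Finset.mem_filter, Finset.mem_univ, true_and] at hq ⊢
    exact ⟨hq.1.trans_le h, hq.2⟩

lemma wordCount_lt {x : ι → ℕ} {P : ℕ → Prop} [DecidablePred P] {i j : ℕ} (h : i ≤ j) {q : ι}
    (h1 : i ≤ r q) (h2 : r q < j) (hq : P (x q)) : wordCount r x P i < wordCount r x P j := by
  refine Finset.card_lt_card ((Finset.ssubset_iff_of_subset fun q hq => ?_).2 ⟨q, ?_, ?_⟩)
  · simp only [Finset.mem_filter, Finset.mem_univ, true_and] at hq ⊢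
    exact ⟨hq.1.trans_le h, hq.2⟩
  · simp [h2, hq]
  · simp [h1]

lemma wordCount_congr {x z : ι → ℕ} (P : ℕ → Prop) [DecidablePred P] {j : ℕ}
    (h : ∀ q, r q < j → x q = z q) : wordCount r x P j = wordCount r z P j := by
  unfold wordCount
  congr 1
  ext q
  simp only [Finset.mem_filter, Finset.mem_univ, true_and]
  exact and_congr_right fun hq => by rw [h q hq]

lemma wordCount_eq_of_forall_not {x : ι → ℕ} {P : ℕ → Prop} [DecidablePred P] {i j : ℕ}
    (hij : i ≤ j) (h : ∀ q, i ≤ r q → r q < j → ¬ P (x q)) :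
    wordCount r x P j = wordCount r x P i := by
  unfold wordCount
  congr 1
  ext q
  simp only [Finset.mem_filter, Finset.mem_univ, true_and]
  refine ⟨fun hq => ⟨?_, hq.2⟩, fun hq => ⟨hq.1.trans_le hij, hq.2⟩⟩
  by_contra hc
  exact h q (not_lt.1 hc) hq.1 hq.2

lemma wordCount_le_eq_add (x : ι → ℕ) {i k : ℕ} (h : i ≤ k) (j : ℕ) :
    wordCount r x (· ≤ k) j
      = wordCount r x (· ≤ i) j + wordCount r x (fun m => i < m ∧ m ≤ k) j := by
  classical
  unfold wordCount
  rw [← Finset.card_union_of_disjoint]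
  · congr 1
    ext q
    simp only [Finset.mem_filter, Finset.mem_univ, true_and, Finset.mem_union]
    omega
  · rw [Finset.disjoint_filter]
    intro q _
    omega

variable [DecidableEq ι]

lemma wordCount_swap_of_not_between (x : ι → ℕ) (P : ℕ → Prop) [DecidablePred P] {a b : ι}
    {j : ℕ} (h : r a < j ↔ r b < j) :
    wordCount r (x ∘ Equiv.swap a b) P j = wordCount r x P j := by
  refine Finset.card_equiv (Equiv.swap a b) fun q => ?_
  simp only [Finset.mem_filter, Finset.mem_univ, true_and, Function.comp_apply]
  refine and_congr_left fun _ => ?_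
  rcases eq_or_ne q a with rfl | ha
  · simp [h]
  rcases eq_or_ne q b with rfl | hb
  · simp [h]
  rw [Equiv.swap_apply_of_ne_of_ne ha hb]

lemma wordCount_swap_of_between (x : ι → ℕ) (P : ℕ → Prop) [DecidablePred P] {a b : ι}
    {j : ℕ} (ha : r a < j) (hb : j ≤ r b) :
    wordCount r (x ∘ Equiv.swap a b) P j + (if P (x a) then 1 else 0)
      = wordCount r x P j + (if P (x b) then 1 else 0) := by
  unfold wordCount
  rw [Finset.card_filter, Finset.card_filter, ← Finset.add_sum_erase _ _ (Finset.mem_univ a),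
    ← Finset.add_sum_erase Finset.univ (fun q => if r q < j ∧ P (x q) then 1 else 0)
      (Finset.mem_univ a)]
  have : ∑ q ∈ Finset.univ.erase a, (if r q < j ∧ P ((x ∘ Equiv.swap a b) q) then 1 else 0)
      = ∑ q ∈ Finset.univ.erase a, (if r q < j ∧ P (x q) then 1 else 0) := by
    refine Finset.sum_congr rfl fun q hq => ?_
    rcases eq_or_ne q b with rfl | hqb
    · simp [not_lt.2 hb]
    · rw [Function.comp_apply, Equiv.swap_apply_of_ne_of_ne (Finset.ne_of_mem_erase hq) hqb]
  rw [this]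
  simp only [Function.comp_apply, Equiv.swap_apply_left, ha, true_and]
  omega

lemma wordDomLE_swap {x : ι → ℕ} {a b : ι} (hr : r a < r b) (hx : x a < x b) :
    WordDomLE r (x ∘ Equiv.swap a b) x := by
  intro i j
  by_cases h : r a < j ∧ j ≤ r b
  · have := wordCount_swap_of_between x (· ≤ i) h.1 h.2
    split_ifs at this <;> omega
  · rw [wordCount_swap_of_not_between]
    omega

/-- A lattice word which strictly dominates another one of the same content admits a swap
decreasing it, but not below the smaller word. -/
theorem exists_swap_of_wordDomLE (hr : Function.Injective r) {x z : ι → ℕ}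
    (hpos : ∀ q, 1 ≤ x q) (hx : IsLatticeWord r x) (hz : IsLatticeWord r z)
    (hcont : ∀ u, (Finset.univ.filter fun q => x q = u).card
      = (Finset.univ.filter fun q => z q = u).card)
    (hdom : WordDomLE r z x) (hne : x ≠ z) :
    ∃ a b, r a < r b ∧ x a < x b ∧
      (∀ c, r a < r c → r c < r b → x c ≠ x a ∧ x c ≠ x b) ∧
      IsLatticeWord r (x ∘ Equiv.swap a b) ∧ WordDomLE r z (x ∘ Equiv.swap a b) := by
  classical
  obtain ⟨p, hp, hpmin⟩ : ∃ p, x p ≠ z p ∧ ∀ q, r q < r p → x q = z q := by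
    obtain ⟨p, hp, hmin⟩ := Finset.exists_min_image (Finset.univ.filter fun q => x q ≠ z q) r
      (by
        obtain ⟨q, hq⟩ := Function.ne_iff.1 hne
        exact ⟨q, by simp [hq]⟩)
    refine ⟨p, by simpa using hp, fun q hq => ?_⟩
    by_contra hc
    exact absurd (hmin q (by simp [hc])) (not_le.2 hq)
  have hcount : ∀ (P : ℕ → Prop) [DecidablePred P],
      wordCount r x P (r p) = wordCount r z P (r p) := fun P _ => wordCount_congr P hpmin
  have hlt : x p < z p := by
    refine lt_of_le_of_ne ?_ hp
    by_contra hc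
    have h1 := hdom (z p) (r p + 1)
    have h2 : wordCount r x (· ≤ z p) (r p + 1) = wordCount r x (· ≤ z p) (r p) :=
      wordCount_eq_of_forall_not (Nat.le_succ _) fun q hq1 hq2 => by
        rw [hr (by omega : r q = r p)]
        exact hc
    have h3 : wordCount r z (· ≤ z p) (r p) < wordCount r z (· ≤ z p) (r p + 1) :=
      wordCount_lt (Nat.le_succ _) le_rfl (Nat.lt_succ_self _) le_rfl
    rw [h2, hcount] at h1
    omega
  have hp1 := hpos p
  -- the letter of `z` at the first difference can be added to the common prefix
  have hadd : wordCount r x (· = z p) (r p) < wordCount r x (· = z p - 1) (r p) := by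
    have h1 := hz (z p - 1) (by omega) (r p + 1)
    rw [Nat.sub_add_cancel (by omega)] at h1
    have h2 : wordCount r z (· = z p - 1) (r p + 1) = wordCount r z (· = z p - 1) (r p) :=
      wordCount_eq_of_forall_not (Nat.le_succ _) fun q hq1 hq2 => by
        rw [hr (by omega : r q = r p)]
        omega
    have h3 : wordCount r z (· = z p) (r p) < wordCount r z (· = z p) (r p + 1) :=
      wordCount_lt (Nat.le_succ _) le_rfl (Nat.lt_succ_self _) rfl
    rw [hcount, hcount]
    omega
  -- The letter at `b` is the earliest one after `p`, with value in `(x p, z p]`, that could extend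
  -- the common prefix to a lattice word. The value `z p` qualifies by `hadd`, and equal contents
  -- force `x` to contain it after `p`.
  obtain ⟨b, ⟨hb1, hb2, hb3, hb4⟩, hbmin⟩ : ∃ b,
      (r p < r b ∧ x p < x b ∧ x b ≤ z p ∧
        wordCount r x (· = x b) (r p) < wordCount r x (· = x b - 1) (r p)) ∧
      ∀ q, r p < r q → x p < x q → x q ≤ z p →
        wordCount r x (· = x q) (r p) < wordCount r x (· = x q - 1) (r p) → r b ≤ r q := by
    obtain ⟨b, hb, hmin⟩ := Finset.exists_min_image (Finset.univ.filter fun b =>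
      r p < r b ∧ x p < x b ∧ x b ≤ z p ∧
        wordCount r x (· = x b) (r p) < wordCount r x (· = x b - 1) (r p)) r (by
      by_contra hc
      rw [Finset.not_nonempty_iff_eq_empty, Finset.filter_eq_empty_iff] at hc
      have hno : ∀ q, x q = z p → r q < r p := by
        intro q hq
        by_contra hqp
        rcases (not_lt.1 hqp).eq_or_lt with h | h
        · exact hp (by rw [← hq, hr h])
        · exact hc (Finset.mem_univ q) ⟨h, by omega, by omega, by rw [hq]; exact hadd⟩
      have h1 : (Finset.univ.filter fun q => x q = z p).card
          ≤ wordCount r x (· = z p) (r p) :=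
        Finset.card_le_card fun q hq => by
          simp only [Finset.mem_filter, Finset.mem_univ, true_and] at hq ⊢
          exact ⟨hno q hq, hq⟩
      have h2 : wordCount r z (· = z p) (r p + 1)
          ≤ (Finset.univ.filter fun q => z q = z p).card :=
        Finset.card_le_card fun q hq => by
          simp only [Finset.mem_filter, Finset.mem_univ, true_and] at hq ⊢
          exact hq.2
      have h3 : wordCount r z (· = z p) (r p) < wordCount r z (· = z p) (r p + 1) :=
        wordCount_lt (Nat.le_succ _) le_rfl (Nat.lt_succ_self _) rfl
      rw [hcont] at h1
      rw [hcount] at h1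
      omega)
    refine ⟨b, by simpa using hb, fun q h1 h2 h3 h4 => hmin q ?_⟩
    simp only [Finset.mem_filter, Finset.mem_univ, true_and]
    exact ⟨h1, h2, h3, h4⟩
  -- Upward induction: an earlier `x b` would contradict the choice of `b`; an `m + 1`, unable to
  -- extend the prefix, would need an `m` after the prefix, which the previous step excludes.
  have hnone : ∀ m, x b ≤ m → m ≤ z p → ∀ c, r p ≤ r c → r c < r b → x c ≠ m := by
    intro m hm
    have key : ∀ c, r p ≤ r c → r c < r b → x p < x c → x c ≤ z p →
        wordCount r x (· = x c - 1) (r p) ≤ wordCount r x (· = x c) (r p) := by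
      intro c h1 h2 h3 h4
      by_contra hc
      have h5 : r p < r c := lt_of_le_of_ne h1 fun h => by rw [hr h] at h3; omega
      have := hbmin c h5 h3 h4 (not_le.1 hc)
      omega
    induction m, hm using Nat.le_induction with
    | base =>
      rintro - c h1 h2 h3
      have := key c h1 h2 (by omega) (by omega)
      rw [h3] at this
      omega
    | succ m hm ih =>
      intro hm2 c h1 h2 h3
      have h4 := key c h1 h2 (by omega) (by omega)
      rw [h3, Nat.add_sub_cancel] at h4
      have h5 := hx m (by omega) (r c + 1)
      have h6 : wordCount r x (· = m) (r c + 1) = wordCount r x (· = m) (r p) :=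
        wordCount_eq_of_forall_not (by omega) fun q hq1 hq2 =>
          ih (by omega) q hq1 (by omega)
      have h7 : wordCount r x (· = m + 1) (r p) < wordCount r x (· = m + 1) (r c + 1) :=
        wordCount_lt (by omega) h1 (Nat.lt_succ_self _) h3
      omega
  -- `a` carries the largest letter not exceeding `z p` between `p` and `b`, at its last occurrence;
  -- hence no letter of `(x a, z p]` occurs there.
  obtain ⟨a', ha', hmax'⟩ := Finset.exists_max_image (Finset.univ.filter fun c =>
    r p ≤ r c ∧ r c < r b ∧ x p ≤ x c ∧ x c ≤ z p) x ⟨p, by simp; omega⟩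
  obtain ⟨a, ha, hmax⟩ := Finset.exists_max_image (Finset.univ.filter fun c =>
    r p ≤ r c ∧ r c < r b ∧ x c = x a') r ⟨a', by simp at ha' ⊢; omega⟩
  simp only [Finset.mem_filter, Finset.mem_univ, true_and] at ha ha' hmax hmax'
  have hnone' : ∀ c, r p ≤ r c → r c < r b → ¬ (x a < x c ∧ x c ≤ z p) := by
    intro c h1 h2 h3
    have := hmax' c ⟨h1, h2, by omega, h3.2⟩
    omega
  have hab : x a < x b := by
    by_contra hc
    exact hnone (x a) (by omega) (by omega) a ha.1 ha.2.1 rfl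
  refine ⟨a, b, ha.2.1, hab, fun c h1 h2 => ⟨fun h => ?_, fun h => ?_⟩, ?_, ?_⟩
  · have := hmax c ⟨by omega, h2, by omega⟩
    omega
  · exact hnone (x b) le_rfl hb3 c (by omega) h2 h
  · intro u hu j
    -- Only cuts between `a` and `b` are affected: `x b` gains one, `x a` loses one. Counts of
    -- letters in `(x a, z p]` still equal their prefix values, so the gain is allowed by `hb4`; the
    -- loss is covered because `a` itself raised the count of `x a` above its prefix value.
    by_cases h : r a < j ∧ j ≤ r b
    · have e1 := wordCount_swap_of_between x (· = u) h.1 h.2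
      have e2 := wordCount_swap_of_between x (· = u + 1) h.1 h.2
      have e3 := hx u hu j
      have hs : wordCount r x (· = x a) (r p) < wordCount r x (· = x a) j :=
        wordCount_lt (by omega) ha.1 h.1 rfl
      have e4 := wordCount_mono x (r := r) (· = u) (show r p ≤ j by omega)
      have hconst : ∀ m, x a < m → m ≤ z p →
          wordCount r x (· = m) j = wordCount r x (· = m) (r p) := fun m hm1 hm2 =>
        wordCount_eq_of_forall_not (by omega) fun q hq1 hq2 hq3 =>
          hnone' q hq1 (by omega) (by omega)
      rcases eq_or_ne (x b) (u + 1) with hv | hv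
      · have e5 := hconst (u + 1) (by omega) (by omega)
        rw [hv, Nat.add_sub_cancel] at hb4
        rcases eq_or_ne (x a) u with hu' | hu'
        · rw [hu'] at hs
          simp only [hv, hu'] at e1 e2
          simp at e1 e2
          omega
        · split_ifs at e1 e2 <;> omega
      · rcases eq_or_ne (x a) u with hu' | hu'
        · have e5 := hconst (u + 1) (by omega) (by omega)
          have e6 := hx u hu (r p)
          rw [hu'] at hs
          split_ifs at e1 e2 <;> omega
        · split_ifs at e1 e2 <;> omega
    · rw [wordCount_swap_of_not_between _ _ (by omega),
        wordCount_swap_of_not_between _ _ (by omega)]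
      exact hx u hu j
  · intro i j
    by_cases h : r a < j ∧ j ≤ r b
    · have e1 := wordCount_swap_of_between x (· ≤ i) h.1 h.2
      have e2 := hdom i j
      -- The count for `x` drops by one, so strict dominance is needed. It holds up to `z p` weakly,
      -- but among letters in `(i, z p]` the word `x` has gained nothing since the prefix, whereas
      -- `z` has gained its letter at `p`.
      by_cases hi : x a ≤ i ∧ i < x b
      · have e3 := wordCount_le_eq_add (r := r) x (show i ≤ z p by omega) j
        have e4 := wordCount_le_eq_add (r := r) z (show i ≤ z p by omega) j
        have e5 := hdom (z p) j
        have e6 : wordCount r x (fun m => i < m ∧ m ≤ z p) j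
            = wordCount r x (fun m => i < m ∧ m ≤ z p) (r p) :=
          wordCount_eq_of_forall_not (by omega) fun q hq1 hq2 hq3 =>
            hnone' q hq1 (by omega) (by omega)
        have e7 : wordCount r z (fun m => i < m ∧ m ≤ z p) (r p)
            < wordCount r z (fun m => i < m ∧ m ≤ z p) j :=
          wordCount_lt (by omega) le_rfl (by omega) (by omega)
        rw [hcount] at e6
        split_ifs at e1 <;> omega
      · split_ifs at e1 <;> omega
    · rw [wordCount_swap_of_not_between _ _ (by omega)]
      exact hdom i j

/-- Termination measure for repeated exchanges: the larger letter moves to the smaller weight. -/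
lemma sum_mul_swap_lt {x : ι → ℕ} {a b : ι} (hr : r a < r b) (hx : x a < x b) :
    ∑ q, r q * (x ∘ Equiv.swap a b) q < ∑ q, r q * x q := by
  have hab : b ∈ Finset.univ.erase a := by
    simp only [Finset.mem_erase, Finset.mem_univ, and_true]
    rintro rfl
    exact lt_irrefl _ hr
  rw [← Finset.add_sum_erase _ _ (Finset.mem_univ a), ← Finset.add_sum_erase _ _ hab,
    ← Finset.add_sum_erase Finset.univ (fun q => r q * x q) (Finset.mem_univ a),
    ← Finset.add_sum_erase _ (fun q => r q * x q) hab]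
  have : ∑ q ∈ (Finset.univ.erase a).erase b, r q * (x ∘ Equiv.swap a b) q
      = ∑ q ∈ (Finset.univ.erase a).erase b, r q * x q := by
    refine Finset.sum_congr rfl fun q hq => ?_
    simp only [Finset.mem_erase, Finset.mem_univ, and_true] at hq
    rw [Function.comp_apply, Equiv.swap_apply_of_ne_of_ne hq.2 hq.1]
  rw [this]
  simp only [Function.comp_apply, Equiv.swap_apply_left, Equiv.swap_apply_right]
  nlinarith [mul_pos (Nat.sub_pos_of_lt hr) (Nat.sub_pos_of_lt hx),
    Nat.sub_add_cancel hr.le, Nat.sub_add_cancel hx.le]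

end Words

variable {α β γ : YoungDiagram}

/-! ### Tableaux on rook strips as words. -/

section Tableaux

/-- The row of a box. -/
def cellRow (p : SkewCell β γ) : ℕ := p.1.1

lemma IsRookStrip.row_injective (h : IsRookStrip β γ) :
    Function.Injective (cellRow : SkewCell β γ → ℕ) := by
  rintro ⟨⟨i, c⟩, hp⟩ ⟨⟨i', d⟩, hq⟩ (rfl : i = i')
  simp only [Finset.mem_sdiff, YoungDiagram.mem_cells, YoungDiagram.mem_iff_lt_rowLen] at hp hq
  have := h.2 i
  obtain rfl : c = d := by omega
  rfl

lemma IsRookStrip.col_injective (h : IsRookStrip β γ) {p q : SkewCell β γ}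
    (hpq : p.1.2 = q.1.2) : p = q := by
  obtain ⟨⟨c, i⟩, hp⟩ := p
  obtain ⟨⟨d, i'⟩, hq⟩ := q
  obtain rfl : i = i' := hpq
  simp only [Finset.mem_sdiff, YoungDiagram.mem_cells, YoungDiagram.mem_iff_lt_colLen] at hp hq
  have := h.1 i
  simp only [YoungDiagram.rowLen_transpose] at this
  obtain rfl : c = d := by omega
  rfl

lemma IsRookStrip.colLen_eq (h : IsRookStrip β γ) (p : SkewCell β γ) :
    β.colLen p.1.2 = p.1.1 + 1 ∧ γ.colLen p.1.2 = p.1.1 := by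
  obtain ⟨⟨c, i⟩, hp⟩ := p
  simp only [Finset.mem_sdiff, YoungDiagram.mem_cells, YoungDiagram.mem_iff_lt_colLen] at hp ⊢
  have := h.1 i
  simp only [YoungDiagram.rowLen_transpose] at this
  omega

/-- If `q` were further right, the box in the row of `p` and the column of `q` would be a second
strip box in that row. -/
lemma IsRookStrip.col_lt (h : IsRookStrip β γ) {p q : SkewCell β γ} (hpq : p.1.1 < q.1.1) :
    q.1.2 < p.1.2 := by
  by_contra hc
  rcases (not_lt.1 hc).eq_or_lt with h1 | h1
  · rw [h.col_injective h1] at hpq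
    exact lt_irrefl _ hpq
  · have hp := Finset.mem_sdiff.1 p.2
    have hq := Finset.mem_sdiff.1 q.2
    have hm : (p.1.1, q.1.2) ∈ β.cells \ γ.cells := Finset.mem_sdiff.2
      ⟨β.isLowerSet (Prod.mk_le_mk.2 ⟨hpq.le, le_rfl⟩ : (p.1.1, q.1.2) ≤ (q.1.1, q.1.2)) hq.1,
        fun hc => hp.2 (γ.isLowerSet
          (Prod.mk_le_mk.2 ⟨le_rfl, h1.le⟩ : (p.1.1, p.1.2) ≤ (p.1.1, q.1.2)) hc)⟩
    have : (⟨_, hm⟩ : SkewCell β γ) = p := h.row_injective rfl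
    rw [← this] at h1
    exact lt_irrefl _ h1

lemma IsRookStrip.col_lt_iff (h : IsRookStrip β γ) {p q : SkewCell β γ} :
    q.1.2 < p.1.2 ↔ p.1.1 < q.1.1 := by
  refine ⟨fun hpq => ?_, h.col_lt⟩
  by_contra hc
  rcases (not_lt.1 hc).eq_or_lt with h1 | h1
  · rw [h.row_injective h1] at hpq
    exact lt_irrefl _ hpq
  · exact lt_asymm hpq (h.col_lt h1)

lemma ncard_setOf_eq_card {ι : Type*} [Fintype ι] (P : ι → Prop) [DecidablePred P] :
    {p | P p}.ncard = (Finset.univ.filter P).card := by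
  rw [← Set.ncard_coe_finset]
  simp

lemma LRTableau.card_entry_eq (X : LRTableau α β γ) (u : ℕ) :
    (Finset.univ.filter fun q => X.entry q = u + 1).card = α.rowLen u := by
  rw [← X.content, ncard_setOf_eq_card]

lemma LRTableau.isLatticeWord (h : IsRookStrip β γ) (X : LRTableau α β γ) :
    IsLatticeWord cellRow X.entry := by
  intro u hu j
  unfold wordCount
  by_cases hne : (Finset.univ.filter fun p : SkewCell β γ => cellRow p < j).Nonempty
  · obtain ⟨p, hp, hmax⟩ := Finset.exists_max_image _ cellRow hne
    simp only [Finset.mem_filter, Finset.mem_univ, true_and] at hp hmax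
    -- The lattice condition at `c` never counts column 0. If the prefix reaches that column it is
    -- the whole word, and the inequality says that the parts of `α` decrease.
    rcases Nat.eq_zero_or_pos p.1.2 with h0 | h0
    · have hall : ∀ q : SkewCell β γ, cellRow q < j := by
        intro q
        by_contra hq
        have := h.col_lt (show p.1.1 < q.1.1 from lt_of_lt_of_le hp (not_lt.1 hq))
        omega
      simp only [hall, true_and]
      obtain ⟨u, rfl⟩ := Nat.exists_eq_add_of_le' hu
      rw [X.card_entry_eq, X.card_entry_eq]
      exact α.rowLen_anti _ _ (Nat.le_succ _)
    · have hiff : ∀ q : SkewCell β γ, p.1.2 - 1 < q.1.2 ↔ cellRow q < j := by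
        intro q
        have h1 : p.1.2 - 1 < q.1.2 ↔ ¬ q.1.2 < p.1.2 := by omega
        rw [h1, h.col_lt_iff]
        refine ⟨fun hq => lt_of_le_of_lt (not_lt.1 hq) hp, fun hq => not_lt.2 (hmax q hq)⟩
      have := X.lattice (u + 1) (by omega) (p.1.2 - 1)
      simp only [hiff, ncard_setOf_eq_card, Nat.add_sub_cancel] at this
      exact this
  · rw [Finset.not_nonempty_iff_eq_empty, Finset.filter_eq_empty_iff] at hne
    have hne' : ∀ p : SkewCell β γ, ¬ cellRow p < j := fun p => hne (Finset.mem_univ p)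
    simp [hne']

/-- A lattice word on a rook strip, regarded as an LR-tableau. -/
def LRTableau.ofWord (h : IsRookStrip β γ) (hle : γ ≤ β) (x : SkewCell β γ → ℕ)
    (hpos : ∀ p, 1 ≤ x p) (hcont : ∀ u, {p | x p = u + 1}.ncard = α.rowLen u)
    (hx : IsLatticeWord cellRow x) : LRTableau α β γ where
  contained := hle
  entry := x
  entry_pos := hpos
  content := hcont
  row_weak p q h1 h2 := by
    rw [h.row_injective h1]
  col_strict p q h1 h2 := by
    rw [h.col_injective h1] at h2
    exact absurd h2 (lt_irrefl _)
  lattice u hu c := by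
    simp only [ncard_setOf_eq_card]
    by_cases hne : (Finset.univ.filter fun p : SkewCell β γ => c < p.1.2).Nonempty
    · obtain ⟨p, hp, hmax⟩ := Finset.exists_max_image _ cellRow hne
      simp only [Finset.mem_filter, Finset.mem_univ, true_and] at hp hmax
      have hiff : ∀ q : SkewCell β γ, c < q.1.2 ↔ cellRow q < cellRow p + 1 := by
        intro q
        refine ⟨fun hq => Nat.lt_succ_of_le (hmax q hq), fun hq => ?_⟩
        rcases (Nat.lt_succ_iff.1 hq).eq_or_lt with h1 | h1
        · rwa [h.row_injective h1]
        · exact hp.trans (h.col_lt h1)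
      have := hx (u - 1) (by omega) (cellRow p + 1)
      rw [Nat.sub_add_cancel hu.le] at this
      simp only [hiff]
      exact this
    · rw [Finset.not_nonempty_iff_eq_empty, Finset.filter_eq_empty_iff] at hne
      have hne' : ∀ p : SkewCell β γ, ¬ c < p.1.2 := fun p => hne (Finset.mem_univ p)
      simp [hne']

lemma sum_rowLen_eq_card (μ : YoungDiagram) (j : ℕ) :
    ∑ i ∈ Finset.range j, μ.rowLen i = (μ.cells.filter fun c => c.1 < j).card := by
  rw [Finset.card_eq_sum_card_fiberwise (f := Prod.fst) (t := Finset.range j)]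
  · refine Finset.sum_congr rfl fun i hi => ?_
    rw [YoungDiagram.rowLen_eq_card, YoungDiagram.row, Finset.filter_filter]
    congr 1
    refine Finset.filter_congr fun c _ => ?_
    rw [Finset.mem_range] at hi
    exact ⟨fun h => ⟨h ▸ hi, h⟩, fun h => h.2⟩
  · intro c hc
    simpa using (Finset.mem_filter.1 hc).2

lemma LRTableau.card_region_filter (X : LRTableau α β γ) (l : ℕ) (P : ℕ × ℕ → Prop)
    [DecidablePred P] : ((X.region l).cells.filter P).card
      = (γ.cells.filter P).card
        + (Finset.univ.filter fun q : SkewCell β γ => P q.1 ∧ X.entry q ≤ l).card := by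
  have : (X.region l).cells.filter P = γ.cells.filter P ∪
      (Finset.univ.filter fun q : SkewCell β γ => P q.1 ∧ X.entry q ≤ l).map
        (Function.Embedding.subtype _) := by
    ext c
    simp only [LRTableau.region, Finset.mem_filter, Finset.mem_union, Finset.mem_map,
      Finset.mem_univ, true_and]
    constructor
    · rintro ⟨h | ⟨q, hq, rfl⟩, hc⟩
      · exact Or.inl ⟨h, hc⟩
      · exact Or.inr ⟨q, ⟨hc, hq⟩, rfl⟩
    · rintro (⟨h, hc⟩ | ⟨q, ⟨hc, hq⟩, rfl⟩)
      · exact ⟨Or.inl h, hc⟩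
      · exact ⟨Or.inr ⟨q, hq, rfl⟩, hc⟩
  rw [this, Finset.card_union_of_disjoint, Finset.card_map]
  rw [Finset.disjoint_left]
  intro c hc hc'
  obtain ⟨q, -, rfl⟩ := Finset.mem_map.1 hc'
  exact (Finset.mem_sdiff.1 q.2).2 (Finset.mem_filter.1 hc).1

/-- The first `j` rows of a region consist of boxes of `γ`, which cancel, and strip boxes with small
entries. -/
lemma domLE_iff {X Z : LRTableau α β γ} : DomLE Z X ↔ WordDomLE cellRow Z.entry X.entry := by
  unfold DomLE PartDomLE WordDomLE wordCount
  simp only [sum_rowLen_eq_card, LRTableau.card_region_filter, Nat.add_le_add_iff_left]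
  rfl

lemma DomLE.refl (X : LRTableau α β γ) : DomLE X X := fun _ _ => le_rfl

lemma DomLE.trans {X Y Z : LRTableau α β γ} (h1 : DomLE X Y) (h2 : DomLE Y Z) : DomLE X Z :=
  fun i j => (h1 i j).trans (h2 i j)

/-- A decreasing exchange of the entries in two boxes, such that neither entry occurs in between. -/
def SimpleMove (X Z : LRTableau α β γ) : Prop :=
  ∃ a b : SkewCell β γ, cellRow a < cellRow b ∧ X.entry a < X.entry b ∧
    (∀ c, cellRow a < cellRow c → cellRow c < cellRow b →
      X.entry c ≠ X.entry a ∧ X.entry c ≠ X.entry b) ∧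
    Z.entry = X.entry ∘ Equiv.swap a b

lemma SimpleMove.boxMove {X Z : LRTableau α β γ} (h : SimpleMove X Z) : BoxMove X Z := by
  obtain ⟨a, b, h1, h2, -, h3⟩ := h
  exact ⟨a, b, h2, h1, 1, 1, fun _ => rfl, fun _ => rfl, fun p => by rw [h3]; rfl⟩

/-- Permutations within rows or within columns of a rook strip are trivial, so the move is a bare
exchange. -/
lemma BoxMove.domLE (h : IsRookStrip β γ) {X Z : LRTableau α β γ} (hm : BoxMove X Z) :
    DomLE Z X := by
  obtain ⟨a, b, h1, h2, r, c, hr, hc, hZ⟩ := hm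
  have : Z.entry = X.entry ∘ Equiv.swap a b := by
    funext p
    rw [hZ, h.row_injective (hr _ : cellRow (r (c p)) = cellRow (c p)), h.col_injective (hc p)]
    rfl
  rw [domLE_iff, this]
  exact wordDomLE_swap h2 h1

lemma BoxLE.domLE (h : IsRookStrip β γ) {X Z : LRTableau α β γ} (hm : BoxLE Z X) :
    DomLE Z X := by
  unfold BoxLE at hm
  induction hm with
  | refl => exact DomLE.refl _
  | tail _ h2 ih => exact (h2.domLE h).trans ih

theorem DomLE.exists_simpleMoves (h : IsRookStrip β γ) {X Z : LRTableau α β γ}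
    (hd : DomLE Z X) : Relation.ReflTransGen SimpleMove X Z := by
  induction hn : ∑ q, cellRow q * X.entry q using Nat.strong_induction_on generalizing X with
  | _ n ih =>
    by_cases hne : X.entry = Z.entry
    · rw [LRTableau.ext hne]
    obtain ⟨a, b, h1, h2, h3, h4, h5⟩ := exists_swap_of_wordDomLE h.row_injective X.entry_pos
      (X.isLatticeWord h) (Z.isLatticeWord h) (fun u => by
        rcases u with - | u
        · rw [Finset.filter_false_of_mem fun q _ => by have := X.entry_pos q; omega,
            Finset.filter_false_of_mem fun q _ => by have := Z.entry_pos q; omega]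
        · rw [X.card_entry_eq, Z.card_entry_eq]) (domLE_iff.1 hd) hne
    let Y : LRTableau α β γ := LRTableau.ofWord h X.contained (X.entry ∘ Equiv.swap a b)
      (fun p => X.entry_pos _)
      (fun u => by
        rw [← X.content u, ncard_setOf_eq_card, ncard_setOf_eq_card]
        exact Finset.card_equiv (Equiv.swap a b) fun q => by simp) h4
    refine Relation.ReflTransGen.head (b := Y) ⟨a, b, h1, h2, h3, rfl⟩ (ih _ ?_ ?_ rfl)
    · rw [← hn]
      exact sum_mul_swap_lt h1 h2
    · exact domLE_iff.2 h5

end Tableaux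

/-! ### Nilpotent operators and identification of their quotients. -/

section Nilpotent

variable {k : Type*} [Field k] {μ ν : YoungDiagram}

/-- The coordinates of a vector of `N_μ`, extended by zero. -/
def coeff (v : NilSpace k μ) (c r : ℕ) : k :=
  if h : (c, r) ∈ μ.cells then v ⟨(c, r), h⟩ else 0

/-- The vector of `N_μ` with prescribed coordinates. -/
def ofCoeff (μ : YoungDiagram) (f : ℕ → ℕ → k) : NilSpace k μ := fun p => f p.1.1 p.1.2

lemma coeff_ofCoeff (f : ℕ → ℕ → k) (c r : ℕ) :
    coeff (ofCoeff μ f) c r = if (c, r) ∈ μ.cells then f c r else 0 := by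
  unfold coeff ofCoeff
  split_ifs <;> rfl

lemma coeff_eq_apply (v : NilSpace k μ) (p : μ.cells) : coeff v p.1.1 p.1.2 = v p :=
  dif_pos p.2

lemma coeff_ext {v w : NilSpace k μ} (h : ∀ c r, coeff v c r = coeff w c r) : v = w := by
  funext p
  rw [← coeff_eq_apply v, ← coeff_eq_apply w, h]

lemma mem_of_coeff_ne_zero {v : NilSpace k μ} {c r : ℕ} (h : coeff v c r ≠ 0) : (c, r) ∈ μ := by
  by_contra hc
  exact h (dif_neg hc)

@[simp] lemma coeff_sub (v w : NilSpace k μ) (c r : ℕ) :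
    coeff (v - w) c r = coeff v c r - coeff w c r := by
  unfold coeff
  split_ifs <;> simp

@[simp] lemma coeff_smul (a : k) (v : NilSpace k μ) (c r : ℕ) :
    coeff (a • v) c r = a * coeff v c r := by
  unfold coeff
  split_ifs <;> simp

@[simp] lemma coeff_zero (c r : ℕ) : coeff (0 : NilSpace k μ) c r = 0 := by
  unfold coeff
  split_ifs <;> rfl

lemma coeff_nilOp (v : NilSpace k μ) (c r : ℕ) :
    coeff (nilOp k μ v) c r = coeff v c (r + 1) := by
  unfold coeff nilOp
  by_cases h : (c, r + 1) ∈ μ.cells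
  · have h' : (c, r) ∈ μ.cells := μ.isLowerSet (Prod.mk_le_mk.2 ⟨le_rfl, Nat.le_succ r⟩) h
    simp only [h, h', dite_true, LinearMap.coe_mk, AddHom.coe_mk]
  · by_cases h' : (c, r) ∈ μ.cells <;>
      simp only [h, h', dite_true, dite_false, LinearMap.coe_mk, AddHom.coe_mk]

lemma coeff_nilOp_pow (s : ℕ) (v : NilSpace k μ) (c r : ℕ) :
    coeff ((nilOp k μ ^ s) v) c r = coeff v c (r + s) := by
  induction s generalizing v with
  | zero => simp
  | succ s ih => rw [pow_succ, Module.End.mul_apply, ih, coeff_nilOp, add_assoc, add_comm s]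

lemma finrank_nilSpace (μ : YoungDiagram) : Module.finrank k (NilSpace k μ) = μ.card := by
  rw [Module.finrank_fintype_fun_eq_card, Fintype.card_coe]

lemma finrank_ker_nilOp_pow (j : ℕ) :
    Module.finrank k (LinearMap.ker (nilOp k μ ^ j)) = (μ.cells.filter fun c => c.2 < j).card := by
  have hker : LinearMap.ker (nilOp k μ ^ j)
      = ⨅ i ∈ {p : μ.cells | j ≤ p.1.2}, LinearMap.ker (LinearMap.proj i) := by
    ext v
    simp only [LinearMap.mem_ker, Submodule.mem_iInf, LinearMap.proj_apply, Set.mem_ofPred_eq]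
    constructor
    · intro h p hp
      have := coeff_nilOp_pow j v p.1.1 (p.1.2 - j)
      rwa [h, coeff_zero, Nat.sub_add_cancel hp, coeff_eq_apply, eq_comm] at this
    · intro h
      refine coeff_ext fun c r => ?_
      rw [coeff_nilOp_pow, coeff_zero]
      by_contra hc
      have := h ⟨(c, r + j), mem_of_coeff_ne_zero hc⟩ (Nat.le_add_left _ _)
      rw [← coeff_eq_apply v] at this
      exact hc this
  rw [hker, (LinearMap.iInfKerProjEquiv k (fun _ : μ.cells => k)
    (I := {p : μ.cells | p.1.2 < j}) (J := {p : μ.cells | j ≤ p.1.2}) ?_ ?_).finrank_eq]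
  · rw [Module.finrank_fintype_fun_eq_card, Fintype.card_subtype]
    refine Finset.card_bij (fun p _ => p.1) ?_ ?_ ?_
    · intro p hp
      exact Finset.mem_filter.2 ⟨p.2, (Finset.mem_filter.1 hp).2⟩
    · intro p _ q _ h
      exact Subtype.ext h
    · intro c hc
      rw [Finset.mem_filter] at hc
      exact ⟨⟨c, hc.1⟩, by simpa using hc.2, rfl⟩
  · rw [Set.disjoint_left]
    intro p hp hp'
    rw [Set.mem_ofPred_eq] at hp hp'
    omega
  · intro p _
    rw [Set.mem_union, Set.mem_ofPred_eq, Set.mem_ofPred_eq]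
    exact lt_or_ge _ _

/-- A triangular system of block generators which are killed modulo `W` by powers of `T` given by
the parts of `ν` exhibits `N_μ / W` as `N_ν`, provided the dimensions fit. -/
theorem quotientIso_of_generators {W : Submodule k (NilSpace k μ)}
    (hT : ∀ w ∈ W, nilOp k μ w ∈ W) (g : ℕ → NilSpace k μ)
    (hlead : ∀ c, 0 < μ.rowLen c → coeff (g c) c (μ.rowLen c - 1) ≠ 0)
    (htri : ∀ c c' r, c < c' → coeff (g c) c' r = 0)
    (hker : ∀ c, (nilOp k μ ^ ν.rowLen c) (g c) ∈ W)
    (hdim : Module.finrank k W + ν.card ≤ μ.card) :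
    QuotientIso k μ W ν ∧ Module.finrank k W + ν.card = μ.card := by
  set T := nilOp k μ with hTdef
  -- `ψ` sends the generator of block `c` to `g c`; it commutes with `T` only modulo `W`, by `hker`.
  let ψ : NilSpace k ν →ₗ[k] NilSpace k μ := Fintype.linearCombination k
    (fun p : ν.cells => (T ^ (ν.rowLen p.1.1 - 1 - p.1.2)) (g p.1.1))
  have hψ : ∀ p : ν.cells, ψ (Pi.single p 1)
      = (T ^ (ν.rowLen p.1.1 - 1 - p.1.2)) (g p.1.1) := fun p => by
    simp [ψ, Fintype.linearCombination_apply_single]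
  have hnil : ∀ p : ν.cells, ∀ h : 0 < p.1.2, nilOp k ν (Pi.single p 1)
      = Pi.single ⟨(p.1.1, p.1.2 - 1), ν.isLowerSet
        (Prod.mk_le_mk.2 ⟨le_rfl, Nat.sub_le _ _⟩ : (p.1.1, p.1.2 - 1) ≤ (p.1.1, p.1.2)) p.2⟩ 1 := by
    intro p h
    refine coeff_ext fun c r => ?_
    rw [coeff_nilOp]
    unfold coeff
    simp only [Pi.single_apply, Subtype.ext_iff, Prod.ext_iff]
    by_cases hc : c = p.1.1 ∧ r + 1 = p.1.2
    · have h2 := ν.isLowerSet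
        (Prod.mk_le_mk.2 ⟨le_rfl, Nat.sub_le _ _⟩ : (p.1.1, p.1.2 - 1) ≤ (p.1.1, p.1.2)) p.2
      have h3 : (p.1.1, p.1.2) ∈ ν.cells := p.2
      have hr : r = p.1.2 - 1 := by omega
      have hr' : r + 1 = p.1.2 := hc.2
      rw [hr', hr, hc.1]
      simpa [h3] using h2
    · have : ¬ (c = p.1.1 ∧ r = p.1.2 - 1) := by omega
      simp [hc, this]
  have hnil0 : ∀ p : ν.cells, p.1.2 = 0 → nilOp k ν (Pi.single p 1) = 0 := by
    intro p h
    refine coeff_ext fun c r => ?_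
    rw [coeff_nilOp]
    unfold coeff
    simp only [Pi.single_apply, Subtype.ext_iff, Prod.ext_iff, h]
    simp
  have hcomm : ∀ v, T (ψ v) - ψ (nilOp k ν v) ∈ W := by
    intro v
    have : (W.mkQ ∘ₗ (T ∘ₗ ψ - ψ ∘ₗ nilOp k ν)) = 0 := by
      refine LinearMap.pi_ext' fun p => LinearMap.ext_ring ?_
      simp only [LinearMap.comp_apply, LinearMap.sub_apply, LinearMap.single_apply,
        LinearMap.zero_apply, Submodule.mkQ_apply, Submodule.Quotient.mk_eq_zero, hψ]
      have hp := YoungDiagram.mem_iff_lt_rowLen.1 (show (p.1.1, p.1.2) ∈ ν from p.2)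
      rcases Nat.eq_zero_or_pos p.1.2 with h0 | h0
      · rw [hnil0 p h0, map_zero, sub_zero, h0, Nat.sub_zero, ← Module.End.mul_apply,
          ← pow_succ', Nat.sub_add_cancel (by omega)]
        exact hker _
      · rw [hnil p h0, hψ, ← Module.End.mul_apply, ← pow_succ']
        have : ν.rowLen p.1.1 - 1 - p.1.2 + 1 = ν.rowLen p.1.1 - 1 - (p.1.2 - 1) := by omega
        simp [this]
    have := LinearMap.congr_fun this v
    simpa only [LinearMap.comp_apply, LinearMap.sub_apply, LinearMap.zero_apply,
      Submodule.mkQ_apply, Submodule.Quotient.mk_eq_zero] using this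
  set V := W ⊔ LinearMap.range ψ with hV
  have hWV : ∀ w ∈ W, w ∈ V := fun w hw => Submodule.mem_sup_left hw
  have hψV : ∀ v, ψ v ∈ V := fun v => Submodule.mem_sup_right ⟨v, rfl⟩
  have hTV : ∀ v ∈ V, T v ∈ V := by
    intro v hv
    obtain ⟨w, hw, _, ⟨u, rfl⟩, rfl⟩ := Submodule.mem_sup.1 hv
    rw [map_add]
    refine V.add_mem (hWV _ (hT _ hw)) ?_
    have := V.add_mem (hWV _ (hcomm u)) (hψV (nilOp k ν u))
    rwa [sub_add_cancel] at this
  have hTV' : ∀ s, ∀ v ∈ V, (T ^ s) v ∈ V := by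
    intro s
    induction s with
    | zero => intro v hv; simpa using hv
    | succ s ih => intro v hv; rw [pow_succ', Module.End.mul_apply]; exact hTV _ (ih v hv)
  have hg : ∀ c, g c ∈ V := by
    intro c
    rcases Nat.eq_zero_or_pos (ν.rowLen c) with h0 | h0
    · have := hker c
      rw [h0] at this
      exact hWV _ (by simpa using this)
    · have := hψV (Pi.single ⟨(c, ν.rowLen c - 1),
        YoungDiagram.mem_iff_lt_rowLen.2 (Nat.sub_lt h0 Nat.one_pos)⟩ 1)
      rw [hψ] at this
      simpa using this
  -- Elimination: a multiple of a `T`-power of `g c` removes the highest coefficient in block `c`,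
  -- and triangularity leaves later blocks untouched.
  have step : ∀ c ρ, (∀ v : NilSpace k μ,
      (∀ c' r, coeff v c' r ≠ 0 → c' < c ∨ (c' = c ∧ r < ρ)) → v ∈ V) → ∀ v : NilSpace k μ,
      (∀ c' r, coeff v c' r ≠ 0 → c' < c ∨ (c' = c ∧ r < ρ + 1)) → v ∈ V := by
    intro c ρ ih v hv
    by_cases h0 : coeff v c ρ = 0
    · refine ih v fun c' r h => (hv c' r h).imp_right fun h1 => ⟨h1.1, ?_⟩
      refine lt_of_le_of_ne (Nat.lt_succ_iff.1 h1.2) ?_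
      rintro rfl
      exact h (h1.1 ▸ h0)
    · have hρ := YoungDiagram.mem_iff_lt_rowLen.1 (mem_of_coeff_ne_zero h0)
      have ha := hlead c (by omega)
      set a := coeff (g c) c (μ.rowLen c - 1) with hadef
      have hmem : (coeff v c ρ / a) • (T ^ (μ.rowLen c - 1 - ρ)) (g c) ∈ V :=
        V.smul_mem _ (hTV' _ _ (hg c))
      refine (V.sub_mem_iff_left hmem).1 (ih _ fun c' r h => ?_)
      rw [coeff_sub, coeff_smul, coeff_nilOp_pow] at h
      by_contra hc
      push Not at hc
      refine h ?_
      rcases hc.1.eq_or_lt with rfl | hlt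
      · rcases (hc.2 rfl).eq_or_lt with rfl | hlt
        · rw [show ρ + (μ.rowLen c - 1 - ρ) = μ.rowLen c - 1 by omega, ← hadef,
            div_mul_cancel₀ _ ha, sub_self]
        · have h1 : coeff v c r = 0 := by
            by_contra h1
            have := hv _ _ h1
            omega
          have h2 : coeff (g c) c (r + (μ.rowLen c - 1 - ρ)) = 0 := by
            by_contra h2
            have := YoungDiagram.mem_iff_lt_rowLen.1 (mem_of_coeff_ne_zero h2)
            omega
          rw [h1, h2, mul_zero, sub_zero]
      · have h1 : coeff v c' r = 0 := by
          by_contra h1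
          have := hv _ _ h1
          omega
        rw [h1, htri _ _ _ hlt, mul_zero, sub_zero]
  have hall : ∀ c ρ, ∀ v : NilSpace k μ,
      (∀ c' r, coeff v c' r ≠ 0 → c' < c ∨ (c' = c ∧ r < ρ)) → v ∈ V := by
    intro c
    induction c with
    | zero =>
      intro ρ
      induction ρ with
      | zero =>
        intro v hv
        have : v = 0 := coeff_ext fun c r => by
          rw [coeff_zero]
          by_contra hc
          have := hv c r hc
          omega
        rw [this]
        exact V.zero_mem
      | succ ρ ih => exact step 0 ρ ih
    | succ c ihc =>
      intro ρ
      induction ρ with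
      | zero =>
        intro v hv
        refine ihc (μ.rowLen c) v fun c' r h => ?_
        have h1 := hv c' r h
        have h2 := YoungDiagram.mem_iff_lt_rowLen.1 (mem_of_coeff_ne_zero h)
        rcases lt_or_ge c' c with h3 | h3
        · exact Or.inl h3
        · obtain rfl : c' = c := by omega
          exact Or.inr ⟨rfl, h2⟩
      | succ ρ ih => exact step (c + 1) ρ ih
  have htop : V = ⊤ := by
    refine eq_top_iff.2 fun v _ => hall (μ.colLen 0) 0 v fun c r h => Or.inl ?_
    rw [← YoungDiagram.mem_iff_lt_colLen]
    exact μ.up_left_mem le_rfl (Nat.zero_le r) (mem_of_coeff_ne_zero h)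
  have hsurj : Function.Surjective (W.mkQ ∘ₗ ψ) := by
    intro x
    obtain ⟨v, rfl⟩ := W.mkQ_surjective x
    have hv : v ∈ V := htop ▸ Submodule.mem_top
    obtain ⟨w, hw, _, ⟨u, rfl⟩, rfl⟩ := Submodule.mem_sup.1 hv
    refine ⟨u, ?_⟩
    rw [map_add, Submodule.mkQ_apply, Submodule.mkQ_apply, (Submodule.Quotient.mk_eq_zero W).2 hw,
      zero_add]
    rfl
  -- Surjectivity gives one dimension inequality, `hdim` the opposite one.
  have hν := finrank_nilSpace (k := k) ν
  have hμ := finrank_nilSpace (k := k) μ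
  have hq := W.finrank_quotient_add_finrank
  have hle := LinearMap.finrank_le_finrank_of_surjective hsurj
  rw [hμ] at hq
  rw [hν] at hle
  have heq : Module.finrank k W + ν.card = μ.card := by omega
  refine ⟨?_, heq⟩
  have hinj : Function.Injective (W.mkQ ∘ₗ ψ) :=
    (LinearMap.injective_iff_surjective_of_finrank_eq_finrank (by rw [hν]; omega)).2 hsurj
  let e := LinearEquiv.ofBijective (W.mkQ ∘ₗ ψ) ⟨hinj, hsurj⟩
  refine ⟨e.symm, fun v => ?_⟩
  rw [LinearEquiv.symm_apply_eq]
  obtain ⟨u, hu⟩ := hsurj (W.mkQ v)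
  have hu' : e.symm (W.mkQ v) = u := by
    rw [LinearEquiv.symm_apply_eq]
    exact hu.symm
  rw [hu']
  change W.mkQ (T v) = W.mkQ (ψ (nilOp k ν u))
  have h1 : v - ψ u ∈ W := (Submodule.Quotient.eq W).1 hu.symm
  have h2 := W.add_mem (hT _ h1) (hcomm u)
  rw [map_sub, sub_add_sub_cancel] at h2
  exact (Submodule.Quotient.eq W).2 h2

end Nilpotent

/-! ### A criterion for membership in a stratum. -/

section Stratum

variable {k : Type*} [Field k]

lemma card_transpose (μ : YoungDiagram) : μ.transpose.card = μ.card :=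
  Finset.card_map _

lemma finrank_ker_nilOp_transpose_pow (μ : YoungDiagram) (j : ℕ) :
    Module.finrank k (LinearMap.ker (nilOp k μ.transpose ^ j))
      = ∑ i ∈ Finset.range j, μ.rowLen i := by
  rw [finrank_ker_nilOp_pow, sum_rowLen_eq_card]
  refine Finset.card_bij' (fun c _ => c.swap) (fun c _ => c.swap) ?_ ?_ ?_ ?_
  · intro c hc
    rw [Finset.mem_filter, YoungDiagram.mem_cells, YoungDiagram.mem_transpose] at hc
    exact Finset.mem_filter.2 hc
  · intro c hc
    rw [Finset.mem_filter] at hc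
    rw [Finset.mem_filter, YoungDiagram.mem_cells, YoungDiagram.mem_transpose]
    exact hc
  · intro c _
    rfl
  · intro c _
    rfl

lemma LRTableau.card_entry_le (X : LRTableau α β γ) (l : ℕ) :
    (Finset.univ.filter fun q => X.entry q ≤ l).card = ∑ i ∈ Finset.range l, α.rowLen i := by
  rw [Finset.card_eq_sum_card_fiberwise (f := fun q => X.entry q - 1) (t := Finset.range l)]
  · refine Finset.sum_congr rfl fun u hu => ?_
    rw [← X.card_entry_eq, Finset.filter_filter]
    congr 1
    refine Finset.filter_congr fun q _ => ?_
    have := X.entry_pos q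
    rw [Finset.mem_range] at hu
    omega
  · intro q hq
    have := X.entry_pos q
    have h := (Finset.mem_filter.1 hq).2
    simp only [Finset.coe_range, Set.mem_Iio]
    omega

lemma LRTableau.card_region (X : LRTableau α β γ) (l : ℕ) :
    (X.region l).card = γ.card + ∑ i ∈ Finset.range l, α.rowLen i := by
  have := X.card_region_filter l (fun _ => True)
  simpa only [Finset.filter_true, true_and, X.card_entry_le] using this

lemma LRTableau.card_skewCell (X : LRTableau α β γ) : Fintype.card (SkewCell β γ) = α.card := by
  obtain ⟨N, hN⟩ : ∃ N, (∀ q, X.entry q ≤ N) ∧ α.colLen 0 ≤ N :=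
    ⟨(∑ q, X.entry q) + α.colLen 0, fun q =>
      (Finset.single_le_sum (fun _ _ => Nat.zero_le _) (Finset.mem_univ q)).trans
        (Nat.le_add_right _ _), Nat.le_add_left _ _⟩
  have h1 := X.card_entry_le N
  rw [Finset.filter_true_of_mem fun q _ => hN.1 q, Finset.card_univ, sum_rowLen_eq_card,
    Finset.filter_true_of_mem] at h1
  · exact h1
  · intro c hc
    have : (c.1, 0) ∈ α := α.up_left_mem le_rfl (Nat.zero_le _) (show (c.1, c.2) ∈ α from hc)
    exact (YoungDiagram.mem_iff_lt_colLen.1 this).trans_le hN.2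

lemma LRTableau.card_add_card (X : LRTableau α β γ) : γ.card + α.card = β.card := by
  rw [← X.card_skewCell, Fintype.card_coe,
    Finset.card_sdiff_of_subset (YoungDiagram.cells_subset_iff.2 X.contained)]
  exact Nat.add_sub_of_le (Finset.card_le_card (YoungDiagram.cells_subset_iff.2 X.contained))

lemma LRTableau.region_zero (X : LRTableau α β γ) : X.region 0 = γ := by
  ext c
  simp only [LRTableau.region, Finset.mem_union, Finset.mem_map, Finset.mem_filter,
    Finset.mem_univ, true_and]
  refine ⟨?_, Or.inl⟩
  rintro (h | ⟨p, hp, -⟩)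
  · exact h
  · have := X.entry_pos p
    omega

lemma pow_comp_of_commute {μ ν : YoungDiagram} {φ : NilSpace k μ →ₗ[k] NilSpace k ν}
    (h : φ ∘ₗ nilOp k μ = nilOp k ν ∘ₗ φ) (s : ℕ) (v : NilSpace k μ) :
    φ ((nilOp k μ ^ s) v) = (nilOp k ν ^ s) (φ v) := by
  induction s generalizing v with
  | zero => simp
  | succ s ih =>
    rw [pow_succ, Module.End.mul_apply, ih, pow_succ, Module.End.mul_apply]
    exact congrArg _ (LinearMap.congr_fun h v)

/-- A homomorphism lies in the stratum of `X` if for every box with entry `u` the image of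
`T ^ (u - 1)` contains the top of a vector of full height in the block given by the column of the
box, with all other components in longer blocks. -/
theorem mem_stratum_of_exists (h : IsRookStrip β γ) (X : LRTableau α β γ)
    (φ : NilSpace k α.transpose →ₗ[k] NilSpace k β.transpose)
    (hφ : φ ∘ₗ nilOp k α.transpose = nilOp k β.transpose ∘ₗ φ)
    (hex : ∀ p : SkewCell β γ, ∃ y ∈ LinearMap.range (nilOp k α.transpose ^ (X.entry p - 1)),
      (∀ c r, coeff (φ y) c r ≠ 0 → c ≤ p.1.2 ∧ (r + p.1.1, c) ∈ β) ∧
        coeff (φ y) p.1.2 0 ≠ 0) :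
    φ ∈ stratum k X := by
  classical
  set T := nilOp k β.transpose with hTdef
  have hpow := pow_comp_of_commute hφ
  have key : ∀ l : ℕ, QuotientIso k β.transpose ((LinearMap.range φ).map (T ^ l))
      (X.region l).transpose ∧ Module.finrank k ((LinearMap.range φ).map (T ^ l))
        + (X.region l).transpose.card = β.transpose.card := by
    intro l
    set W := (LinearMap.range φ).map (T ^ l) with hW
    have hmemW : ∀ x, x ∈ W ↔ ∃ v, (T ^ l) (φ v) = x := by
      intro x
      rw [hW, Submodule.mem_map]
      constructor
      · rintro ⟨_, ⟨v, rfl⟩, rfl⟩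
        exact ⟨v, rfl⟩
      · rintro ⟨v, rfl⟩
        exact ⟨_, ⟨v, rfl⟩, rfl⟩
    have hT : ∀ w ∈ W, T w ∈ W := by
      intro w hw
      obtain ⟨v, rfl⟩ := (hmemW w).1 hw
      refine (hmemW _).2 ⟨nilOp k α.transpose v, ?_⟩
      have : φ (nilOp k α.transpose v) = T (φ v) := LinearMap.congr_fun hφ v
      rw [this, ← Module.End.mul_apply, ← Module.End.mul_apply, ← pow_succ, ← pow_succ']
    have hT' : ∀ s, ∀ w ∈ W, (T ^ s) w ∈ W := by
      intro s
      induction s with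
      | zero => intro v hv; simpa using hv
      | succ s ih => intro v hv; rw [pow_succ', Module.End.mul_apply]; exact hT _ (ih v hv)
    have hgen : ∀ c, ∃ g : NilSpace k β.transpose,
        (0 < β.transpose.rowLen c → coeff g c (β.transpose.rowLen c - 1) ≠ 0) ∧
        (∀ c' r, c < c' → coeff g c' r = 0) ∧
        (T ^ (X.region l).transpose.rowLen c) g ∈ W := by
      intro c
      -- When the box `p` of this column is outside the region, `φ y` lies in `W` since `l ≤ X.entry
      -- p - 1`, and the support condition allows dividing it by `T ^ p.1.1` to get a generator of
      -- full height.
      by_cases hc : ∃ p : SkewCell β γ, p.1.2 = c ∧ l < X.entry p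
      · obtain ⟨p, rfl, hl⟩ := hc
        obtain ⟨y, ⟨y', rfl⟩, hy1, hy2⟩ := hex p
        set b := φ ((nilOp k α.transpose ^ (X.entry p - 1)) y') with hb
        let g : NilSpace k β.transpose := ofCoeff _ fun c r =>
          if r < p.1.1 then 0 else coeff b c (r - p.1.1)
        have hgb : (T ^ p.1.1) g = b := by
          refine coeff_ext fun c r => ?_
          rw [coeff_nilOp_pow, coeff_ofCoeff, if_neg (by omega : ¬ r + p.1.1 < p.1.1),
            Nat.add_sub_cancel]
          split_ifs with h1
          · rfl
          · by_contra h2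
            refine h1 ?_
            rw [YoungDiagram.mem_cells, YoungDiagram.mem_transpose]
            exact (hy1 c r (Ne.symm h2)).2
        have hbW : b ∈ W := by
          refine (hmemW _).2 ⟨(nilOp k α.transpose ^ (X.entry p - 1 - l)) y', ?_⟩
          rw [hpow, ← Module.End.mul_apply, ← pow_add, hb, hpow]
          congr 2
          omega
        refine ⟨g, fun _ => ?_, fun c' r hc' => ?_, ?_⟩
        · rw [YoungDiagram.rowLen_transpose, (h.colLen_eq p).1, coeff_ofCoeff, if_pos, if_neg]
          · simpa using hy2
          · omega
          · rw [YoungDiagram.mem_cells, YoungDiagram.mem_transpose]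
            exact (Finset.mem_sdiff.1 p.2).1
        · by_contra hne
          rw [coeff_ofCoeff] at hne
          split_ifs at hne with h1 h2
          · exact hne rfl
          · have := (hy1 _ _ hne).1
            omega
          · exact hne rfl
        · have hle : p.1.1 ≤ (X.region l).transpose.rowLen p.1.2 := by
            rw [YoungDiagram.rowLen_transpose]
            by_contra hlt
            have h1 : ((X.region l).colLen p.1.2, p.1.2) ∈ γ := by
              rw [YoungDiagram.mem_iff_lt_colLen, (h.colLen_eq p).2]
              omega
            have h2 : ((X.region l).colLen p.1.2, p.1.2) ∈ X.region l :=
              Finset.mem_union_left _ h1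
            exact lt_irrefl _ (YoungDiagram.mem_iff_lt_colLen.1 h2)
          rw [← Nat.sub_add_cancel hle, pow_add, Module.End.mul_apply, hgb]
          exact hT' _ _ hbW
      -- Otherwise the region contains the whole column of `β`, and the standard generator of the
      -- block works.
      · refine ⟨ofCoeff _ fun c' r => if c' = c ∧ r = β.transpose.rowLen c - 1 then 1 else 0,
          fun h0 => ?_, fun c' r hc' => ?_, ?_⟩
        · rw [coeff_ofCoeff, if_pos]
          · simp
          · exact YoungDiagram.mem_iff_lt_rowLen.2 (by omega)
        · rw [coeff_ofCoeff, if_neg (by omega : ¬ (c' = c ∧ r = β.transpose.rowLen c - 1)), ite_self]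
        · have hle : β.transpose.rowLen c ≤ (X.region l).transpose.rowLen c := by
            rw [YoungDiagram.rowLen_transpose, YoungDiagram.rowLen_transpose]
            by_contra hlt
            have h1 : ((X.region l).colLen c, c) ∈ β := by
              rw [YoungDiagram.mem_iff_lt_colLen]
              omega
            refine lt_irrefl _ (YoungDiagram.mem_iff_lt_colLen.1
              (show ((X.region l).colLen c, c) ∈ X.region l from ?_))
            by_cases h2 : ((X.region l).colLen c, c) ∈ γ
            · exact Finset.mem_union_left _ h2
            · refine Finset.mem_union_right _ (Finset.mem_map.2
                ⟨⟨_, Finset.mem_sdiff.2 ⟨h1, h2⟩⟩, ?_, rfl⟩)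
              simp only [Finset.mem_filter, Finset.mem_univ, true_and]
              by_contra h3
              exact hc ⟨⟨_, Finset.mem_sdiff.2 ⟨h1, h2⟩⟩, rfl, not_le.1 h3⟩
          convert W.zero_mem
          refine coeff_ext fun c' r => ?_
          rw [coeff_nilOp_pow, coeff_ofCoeff, coeff_zero]
          split_ifs with h1 h2
          · have := YoungDiagram.mem_iff_lt_rowLen.1 (show (c', _) ∈ β.transpose from h1)
            rw [h2.1] at this
            omega
          · rfl
          · rfl
    choose g hg1 hg2 hg3 using hgen
    refine quotientIso_of_generators hT g hg1 hg2 hg3 ?_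
    -- `W` is the `φ`-image of the range of `T ^ l`, so this bound does not presuppose injectivity;
    -- the generators turn it into an equality, which at `l = 0` yields injectivity.
    have hWle : Module.finrank k W
        ≤ Module.finrank k (LinearMap.range (nilOp k α.transpose ^ l)) := by
      have : W = (LinearMap.range (nilOp k α.transpose ^ l)).map φ := by
        ext x
        rw [hmemW, Submodule.mem_map]
        constructor
        · rintro ⟨v, rfl⟩
          exact ⟨_, ⟨v, rfl⟩, hpow l v⟩
        · rintro ⟨_, ⟨v, rfl⟩, rfl⟩
          exact ⟨v, (hpow l v).symm⟩
      rw [this]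
      exact Submodule.finrank_map_le _ _
    have hrk := LinearMap.finrank_range_add_finrank_ker (nilOp k α.transpose ^ l)
    rw [finrank_ker_nilOp_transpose_pow, finrank_nilSpace, card_transpose] at hrk
    rw [card_transpose, card_transpose, X.card_region, ← X.card_add_card]
    omega
  have h0 := key 0
  rw [X.region_zero, pow_zero, Module.End.one_eq_id, Submodule.map_id] at h0
  refine ⟨⟨hφ, ?_, h0.1⟩, fun l => (key l).1⟩
  rw [← LinearMap.ker_eq_bot, ← Submodule.finrank_eq_zero (R := k)]
  have hrk := LinearMap.finrank_range_add_finrank_ker φ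
  have h1 := h0.2
  rw [card_transpose, card_transpose, ← X.card_add_card] at h1
  rw [finrank_nilSpace, card_transpose] at hrk
  omega

end Stratum

/-! ### Homomorphisms with Toeplitz blocks, and Zariski limits along lines. -/

section Toeplitz

variable {k : Type*} [Field k] {μ ν : YoungDiagram}

/-- The standard basis vector of `N_μ` given by a box. -/
def basisVec (k : Type*) [Field k] (μ : YoungDiagram) (m s : ℕ) : NilSpace k μ :=
  ofCoeff μ fun c r => if c = m ∧ r = s then 1 else 0

lemma coeff_basisVec {m s : ℕ} (h : (m, s) ∈ μ) (c r : ℕ) :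
    coeff (basisVec k μ m s) c r = if c = m ∧ r = s then 1 else 0 := by
  rw [basisVec, coeff_ofCoeff]
  split_ifs with h1 h2 h2
  · rfl
  · rfl
  · rw [h2.1, h2.2] at h1
    exact absurd h h1
  · rfl

lemma single_eq_basisVec (p : μ.cells) :
    (Pi.single p 1 : NilSpace k μ) = basisVec k μ p.1.1 p.1.2 := by
  funext q
  rw [← coeff_eq_apply (basisVec k μ p.1.1 p.1.2), coeff_basisVec p.2]
  simp only [Pi.single_apply, Subtype.ext_iff, Prod.ext_iff]

lemma nilOp_pow_basisVec {m s i : ℕ} (h : (m, s + i) ∈ μ) :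
    (nilOp k μ ^ i) (basisVec k μ m (s + i)) = basisVec k μ m s := by
  have h' : (m, s) ∈ μ := μ.up_left_mem le_rfl (Nat.le_add_right _ _) h
  refine coeff_ext fun c r => ?_
  rw [coeff_nilOp_pow, coeff_basisVec h, coeff_basisVec h']
  simp

lemma nilOp_basisVec_zero (m : ℕ) : nilOp k μ (basisVec k μ m 0) = 0 := by
  refine coeff_ext fun c r => ?_
  rw [coeff_nilOp, basisVec, coeff_ofCoeff, if_neg (by omega : ¬ (c = m ∧ r + 1 = 0)), ite_self,
    coeff_zero]

/-- The vector `T ^ u e` for the generator `e` of the block `m` of `N_μ`. -/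
def blockVec (k : Type*) [Field k] (μ : YoungDiagram) (m u : ℕ) : NilSpace k μ :=
  basisVec k μ m (μ.rowLen m - 1 - u)

lemma blockVec_mem_range {m u i : ℕ} (h : (m, u) ∈ μ) (hi : i ≤ u) :
    blockVec k μ m u ∈ LinearMap.range (nilOp k μ ^ i) := by
  have hu := YoungDiagram.mem_iff_lt_rowLen.1 h
  exact ⟨_, nilOp_pow_basisVec (YoungDiagram.mem_iff_lt_rowLen.2 (by omega))⟩

/-- The linear map `N_μ → N_ν` for which the matrix block corresponding to the Jordan blocks
`m` and `c` is the Toeplitz matrix with the entries `K c m`. -/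
def toeplitz (μ ν : YoungDiagram) (K : ℕ → ℕ → ℕ → k) : NilSpace k μ →ₗ[k] NilSpace k ν :=
  Matrix.toLin' (Matrix.of fun p q => K p.1.1 q.1.1 (p.1.2 + (μ.rowLen q.1.1 - 1 - q.1.2)))

lemma coords_toeplitz (K : ℕ → ℕ → ℕ → k) (p : ν.cells × μ.cells) :
    coords k (toeplitz μ ν K) p
      = K p.1.1.1 p.2.1.1 (p.1.1.2 + (μ.rowLen p.2.1.1 - 1 - p.2.1.2)) := by
  simp [coords, toeplitz]

variable {K : ℕ → ℕ → ℕ → k}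

lemma coeff_toeplitz_basisVec (hK : ∀ c m u, K c m u ≠ 0 → (m, u) ∈ μ ∧ (c, u) ∈ ν)
    {m s : ℕ} (h : (m, s) ∈ μ) (c r : ℕ) :
    coeff (toeplitz μ ν K (basisVec k μ m s)) c r = K c m (r + (μ.rowLen m - 1 - s)) := by
  have : basisVec k μ m s = Pi.single (⟨(m, s), h⟩ : μ.cells) 1 :=
    (single_eq_basisVec (⟨(m, s), h⟩ : μ.cells)).symm
  rw [this, toeplitz, Matrix.toLin'_apply, Matrix.mulVec_single_one]
  unfold coeff
  split_ifs with h1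
  · rfl
  · by_contra h2
    exact h1 (ν.up_left_mem le_rfl (Nat.le_add_right _ _) (hK _ _ _ (Ne.symm h2)).2)

lemma coeff_toeplitz_blockVec (hK : ∀ c m u, K c m u ≠ 0 → (m, u) ∈ μ ∧ (c, u) ∈ ν)
    {m u : ℕ} (h : (m, u) ∈ μ) (c r : ℕ) :
    coeff (toeplitz μ ν K (blockVec k μ m u)) c r = K c m (r + u) := by
  have hu := YoungDiagram.mem_iff_lt_rowLen.1 h
  rw [blockVec, coeff_toeplitz_basisVec hK (YoungDiagram.mem_iff_lt_rowLen.2 (by omega))]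
  congr 2
  omega

/-- Both composites shift the Toeplitz index by one. At the bottom vector of a block, `(m, u) ∈ μ`
on the support makes `T` kill the image. -/
lemma toeplitz_comp_nilOp (hK : ∀ c m u, K c m u ≠ 0 → (m, u) ∈ μ ∧ (c, u) ∈ ν) :
    toeplitz μ ν K ∘ₗ nilOp k μ = nilOp k ν ∘ₗ toeplitz μ ν K := by
  refine LinearMap.pi_ext' fun ⟨⟨m, s⟩, hp⟩ => LinearMap.ext_ring (coeff_ext fun c r => ?_)
  simp only [LinearMap.comp_apply, LinearMap.single_apply]
  have hp' := YoungDiagram.mem_iff_lt_rowLen.1 (show (m, s) ∈ μ from hp)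
  rw [single_eq_basisVec, coeff_nilOp, coeff_toeplitz_basisVec hK hp]
  rcases s with - | s
  · rw [nilOp_basisVec_zero, map_zero, coeff_zero]
    by_contra h
    have := YoungDiagram.mem_iff_lt_rowLen.1 (hK _ _ _ (Ne.symm h)).1
    omega
  · have h1 := nilOp_pow_basisVec (k := k) (i := 1) (show (m, s + 1) ∈ μ from hp)
    rw [pow_one] at h1
    rw [h1, coeff_toeplitz_basisVec hK (YoungDiagram.mem_iff_lt_rowLen.2 (by omega))]
    congr 1
    omega

/-- A polynomial vanishing on `S` restricts to the line as a one-variable polynomial with infinitely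
many roots, hence zero. -/
lemma mem_zariskiClosure_of_line [Infinite k] {S : Set (NilSpace k μ →ₗ[k] NilSpace k ν)}
    (φ : k → NilSpace k μ →ₗ[k] NilSpace k ν)
    (hφ : ∀ p, ∃ A B, ∀ t, coords k (φ t) p = A + t * B) (hS : ∀ t, t ≠ 0 → φ t ∈ S) :
    φ 0 ∈ zariskiClosure k S := by
  choose A B hφ using hφ
  refine MvPolynomial.mem_zeroLocus_iff.2 fun P hP => ?_
  rw [MvPolynomial.mem_vanishingIdeal_iff] at hP
  let q : Polynomial k :=
    MvPolynomial.aeval (fun p => Polynomial.C (A p) + Polynomial.X * Polynomial.C (B p)) P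
  have hq : ∀ t, q.eval t = MvPolynomial.aeval (coords k (φ t)) P := by
    intro t
    have h1 : (Polynomial.aeval t) q = MvPolynomial.aeval (coords k (φ t)) P := by
      change (Polynomial.aeval t) (MvPolynomial.aeval _ P) = _
      rw [MvPolynomial.comp_aeval_apply]
      congr 2
      funext p
      simp [hφ]
      ring
    rw [← h1, Polynomial.coe_aeval_eq_eval]
  have hq0 : q = 0 := by
    refine Polynomial.eq_zero_of_infinite_isRoot q (Set.Infinite.mono ?_
      (Set.finite_singleton (0 : k)).infinite_compl)
    intro t ht
    exact (hq t).trans (hP _ ⟨_, hS t ht, rfl⟩)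
  rw [← hq, hq0, Polynomial.eval_zero]

end Toeplitz

/-! ### Poles: labelling strip boxes by boxes of `α`. -/

section Labels

/-- The number of equal entries in higher rows. -/
def LRTableau.rank (X : LRTableau α β γ) (p : SkewCell β γ) : ℕ :=
  wordCount cellRow X.entry (· = X.entry p) (cellRow p)

lemma LRTableau.mem_of_rank (X : LRTableau α β γ) (p : SkewCell β γ) :
    (X.entry p - 1, X.rank p) ∈ α := by
  have hp := X.entry_pos p
  rw [YoungDiagram.mem_iff_lt_rowLen, ← X.card_entry_eq, Nat.sub_add_cancel hp]
  refine Finset.card_lt_card ((Finset.ssubset_iff_of_subset fun q hq => ?_).2 ⟨p, ?_, ?_⟩)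
  · simp only [Finset.mem_filter, Finset.mem_univ, true_and] at hq ⊢
    exact hq.2
  · simp
  · simp

lemma LRTableau.rank_lt (X : LRTableau α β γ) {p q : SkewCell β γ} (he : X.entry p = X.entry q)
    (hr : cellRow p < cellRow q) : X.rank p < X.rank q := by
  unfold LRTableau.rank
  rw [he]
  exact wordCount_lt hr.le le_rfl hr he

lemma LRTableau.eq_of_rank_eq (h : IsRookStrip β γ) (X : LRTableau α β γ) {p q : SkewCell β γ}
    (he : X.entry p = X.entry q) (hr : X.rank p = X.rank q) : p = q := by
  rcases lt_trichotomy (cellRow p) (cellRow q) with h1 | h1 | h1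
  · exact absurd hr (X.rank_lt he h1).ne
  · exact h.row_injective h1
  · exact absurd hr (X.rank_lt he.symm h1).ne'

/-- Entry and rank label the strip boxes injectively by boxes of `α`, and the cardinalities agree. A
column of `α` thus labels one pole. -/
lemma LRTableau.exists_rank_eq (h : IsRookStrip β γ) (X : LRTableau α β γ) {u m : ℕ}
    (hm : (u, m) ∈ α) : ∃ p, X.entry p = u + 1 ∧ X.rank p = m := by
  let f : SkewCell β γ → α.cells := fun p => ⟨(X.entry p - 1, X.rank p), X.mem_of_rank p⟩
  have hf : Function.Bijective f := by
    rw [Fintype.bijective_iff_injective_and_card, X.card_skewCell, Fintype.card_coe]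
    refine ⟨fun p q hpq => ?_, rfl⟩
    have h1 := congrArg Subtype.val hpq
    simp only [f, Prod.mk.injEq] at h1
    have hp := X.entry_pos p
    have hq := X.entry_pos q
    exact X.eq_of_rank_eq h (by omega) h1.2
  obtain ⟨p, hp⟩ := hf.2 ⟨(u, m), hm⟩
  have h1 := congrArg Subtype.val hp
  simp only [f, Prod.mk.injEq] at h1
  have hp := X.entry_pos p
  exact ⟨p, by omega, h1.2⟩

/-- Otherwise the prefix ending at `q` would contain more letters `X.entry q` than letters `X.entry
p`. -/
lemma LRTableau.row_lt_of_rank_eq (h : IsRookStrip β γ) (X : LRTableau α β γ)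
    {p q : SkewCell β γ} (he : X.entry q = X.entry p + 1) (hr : X.rank p = X.rank q) :
    cellRow p < cellRow q := by
  by_contra hc
  rcases (not_lt.1 hc).eq_or_lt with h1 | h1
  · rw [h.row_injective h1] at he
    omega
  · have h2 := X.isLatticeWord h (X.entry p) (X.entry_pos p) (cellRow q + 1)
    have h3 : wordCount cellRow X.entry (· = X.entry p) (cellRow q + 1) ≤ X.rank p :=
      wordCount_mono _ _ h1
    have h4 : X.rank q < wordCount cellRow X.entry (· = X.entry q) (cellRow q + 1) :=
      wordCount_lt (Nat.le_succ _) le_rfl (Nat.lt_succ_self _) rfl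
    rw [he] at h4
    omega

/-- A pole has a box for every intermediate entry, each strictly below the preceding one. -/
lemma LRTableau.row_add_le (h : IsRookStrip β γ) (X : LRTableau α β γ) {p q : SkewCell β γ}
    {i : ℕ} (he : X.entry q = X.entry p + i) (hr : X.rank p = X.rank q) :
    cellRow p + i ≤ cellRow q := by
  induction i generalizing q with
  | zero =>
    rw [X.eq_of_rank_eq h he.symm hr]
    exact le_rfl
  | succ i ih =>
    have hq := X.mem_of_rank q
    have hp := X.entry_pos p
    obtain ⟨q', h1, h2⟩ := X.exists_rank_eq h (u := X.entry q - 2) (m := X.rank q)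
      (α.up_left_mem (by omega) le_rfl hq)
    have h3 := ih (q := q') (by omega) (by rw [h2, hr])
    have h4 := X.row_lt_of_rank_eq h (p := q') (q := q) (by omega) h2
    omega

lemma LRTableau.entry_le_row (h : IsRookStrip β γ) (X : LRTableau α β γ) (p : SkewCell β γ) :
    X.entry p ≤ cellRow p + 1 := by
  have hp := X.entry_pos p
  obtain ⟨q, h1, h2⟩ := X.exists_rank_eq h (u := 0) (m := X.rank p)
    (α.up_left_mem (Nat.zero_le _) le_rfl (X.mem_of_rank p))
  have := X.row_add_le h (p := q) (q := p) (i := X.entry p - 1) (by omega) h2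
  omega

/-- Ranks travel with the entries because neither exchanged letter occurs between `a` and `b`;
simple moves carry that condition for this purpose. -/
lemma rank_swap (h : IsRookStrip β γ) {X Z : LRTableau α β γ} {a b : SkewCell β γ}
    (hr : cellRow a < cellRow b) (hx : X.entry a < X.entry b)
    (hbetween : ∀ c, cellRow a < cellRow c → cellRow c < cellRow b →
      X.entry c ≠ X.entry a ∧ X.entry c ≠ X.entry b)
    (hZ : Z.entry = X.entry ∘ Equiv.swap a b) (p : SkewCell β γ) :
    Z.rank p = X.rank (Equiv.swap a b p) := by
  unfold LRTableau.rank
  rw [hZ, Function.comp_apply]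
  rcases eq_or_ne p a with rfl | hpa
  · rw [Equiv.swap_apply_left, wordCount_swap_of_not_between _ _ (by omega)]
    refine (wordCount_eq_of_forall_not hr.le fun q h1 h2 h3 => ?_).symm
    rcases h1.eq_or_lt with h4 | h4
    · rw [← h.row_injective h4] at h3
      omega
    · exact (hbetween q h4 h2).2 h3
  rcases eq_or_ne p b with rfl | hpb
  · rw [Equiv.swap_apply_right, ← wordCount_swap_of_not_between (a := a) (b := p) X.entry
      (· = X.entry a) (j := cellRow a) (by omega)]
    refine wordCount_eq_of_forall_not hr.le fun q h1 h2 h3 => ?_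
    rcases h1.eq_or_lt with h4 | h4
    · rw [← h.row_injective h4, Function.comp_apply, Equiv.swap_apply_left] at h3
      omega
    · rw [Function.comp_apply, Equiv.swap_apply_of_ne_of_ne] at h3
      · exact (hbetween q h4 h2).1 h3
      · rintro rfl
        omega
      · rintro rfl
        omega
  rw [Equiv.swap_apply_of_ne_of_ne hpa hpb]
  by_cases hb : cellRow a < cellRow p ∧ cellRow p ≤ cellRow b
  · have h1 : cellRow p < cellRow b := lt_of_le_of_ne hb.2 fun h1 => hpb (h.row_injective h1)
    have h2 := wordCount_swap_of_between X.entry (· = X.entry p) hb.1 hb.2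
    rw [if_neg (hbetween p hb.1 h1).1.symm, if_neg (hbetween p hb.1 h1).2.symm] at h2
    exact h2
  · exact wordCount_swap_of_not_between _ _ (by omega)

end Labels

/-! ### One-parameter degenerations realising simple moves. -/

section Degeneration

open Classical in
/-- The block coefficients of the embedding which is a sum of poles, one for each column of `α`:
the generator of block `m` has the components given by the `m`-th occurrences of the entries. -/
def LRTableau.poleCoeff (k : Type*) [Field k] (X : LRTableau α β γ) (c m u : ℕ) : k :=
  if ∃ p : SkewCell β γ, p.1.2 = c ∧ X.entry p = u + 1 ∧ X.rank p = m then 1 else 0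

variable {k : Type*} [Field k]

lemma LRTableau.poleCoeff_ne_zero_iff {X : LRTableau α β γ} {c m u : ℕ} :
    X.poleCoeff k c m u ≠ 0
      ↔ ∃ p : SkewCell β γ, p.1.2 = c ∧ X.entry p = u + 1 ∧ X.rank p = m := by
  unfold LRTableau.poleCoeff
  split_ifs with h <;> simp only [ne_eq, one_ne_zero, not_false_eq_true, not_true_eq_false, h]

lemma LRTableau.poleCoeff_of_ne_zero {X : LRTableau α β γ} {c m u : ℕ}
    (h : X.poleCoeff k c m u ≠ 0) : X.poleCoeff k c m u = 1 :=
  if_pos (LRTableau.poleCoeff_ne_zero_iff.1 h)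

/-- Converts row estimates along poles into the support hypothesis of `mem_stratum_of_exists`. -/
lemma IsRookStrip.shifted_mem (h : IsRookStrip β γ) {p q : SkewCell β γ} {r : ℕ}
    (hr : cellRow p + r ≤ cellRow q) : q.1.2 ≤ p.1.2 ∧ (r + p.1.1, q.1.2) ∈ β := by
  constructor
  · by_contra hc
    have h1 : q.1.1 < p.1.1 := h.col_lt_iff.1 (not_le.1 hc)
    have h2 : p.1.1 + r ≤ q.1.1 := hr
    omega
  · exact β.up_left_mem (show r + p.1.1 ≤ q.1.1 from by rw [add_comm]; exact hr) le_rfl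
      (Finset.mem_sdiff.1 q.2).1

lemma LRTableau.mem_of_poleCoeff_ne_zero (h : IsRookStrip β γ) (X : LRTableau α β γ) {c m u : ℕ}
    (hne : X.poleCoeff k c m u ≠ 0) : (m, u) ∈ α.transpose ∧ (c, u) ∈ β.transpose := by
  obtain ⟨p, rfl, h1, rfl⟩ := LRTableau.poleCoeff_ne_zero_iff.1 hne
  rw [YoungDiagram.mem_transpose, YoungDiagram.mem_transpose]
  have h2 := X.mem_of_rank p
  rw [h1, Nat.add_sub_cancel] at h2
  have h3 := X.entry_le_row h p
  exact ⟨h2, β.up_left_mem (show u ≤ p.1.1 from by unfold cellRow at h3; omega) le_rfl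
      (Finset.mem_sdiff.1 p.2).1⟩

/-- For the box `p`, apply `T ^ (X.entry p - 1)` to the generator of its pole. The image is the
bottom vector in the column of `p` plus terms from later boxes `q` of the pole at height `X.entry q
- X.entry p`, which `row_add_le` bounds by the row difference. -/
theorem toeplitz_poleCoeff_mem_stratum (h : IsRookStrip β γ) (X : LRTableau α β γ) :
    toeplitz _ _ (X.poleCoeff k) ∈ stratum k X := by
  have hK := fun c m u => X.mem_of_poleCoeff_ne_zero (k := k) h (c := c) (m := m) (u := u)
  refine mem_stratum_of_exists h X _ (toeplitz_comp_nilOp hK) fun p => ?_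
  have hp := X.entry_pos p
  have hm : (X.rank p, X.entry p - 1) ∈ α.transpose :=
    YoungDiagram.mem_transpose.2 (X.mem_of_rank p)
  refine ⟨_, blockVec_mem_range hm le_rfl, fun c r hc => ?_, ?_⟩
  · rw [coeff_toeplitz_blockVec hK hm] at hc
    obtain ⟨q, rfl, h1, h2⟩ := LRTableau.poleCoeff_ne_zero_iff.1 hc
    exact h.shifted_mem (X.row_add_le h (by omega) h2.symm)
  · rw [coeff_toeplitz_blockVec hK hm, LRTableau.poleCoeff_ne_zero_iff]
    exact ⟨p, rfl, by omega, rfl⟩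

/-- The deformation of the sum of poles for `X` which adds, in the column of the box `a`, a
component to the generator of the pole through the box `b`. -/
def LRTableau.deformCoeff (X : LRTableau α β γ) (a b : SkewCell β γ) (t : k) (c m u : ℕ) : k :=
  X.poleCoeff k c m u + t * if c = a.1.2 ∧ m = X.rank b ∧ u + 1 = X.entry b then 1 else 0

theorem toeplitz_deformCoeff_mem_stratum (h : IsRookStrip β γ) {X Z : LRTableau α β γ}
    {a b : SkewCell β γ} (hr : cellRow a < cellRow b) (hx : X.entry a < X.entry b)
    (hbetween : ∀ c, cellRow a < cellRow c → cellRow c < cellRow b →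
      X.entry c ≠ X.entry a ∧ X.entry c ≠ X.entry b)
    (hZ : Z.entry = X.entry ∘ Equiv.swap a b) {t : k} (ht : t ≠ 0) :
    toeplitz _ _ (X.deformCoeff a b t) ∈ stratum k Z := by
  have hrank := rank_swap h hr hx hbetween hZ
  have hentry : ∀ p, Z.entry p = X.entry (Equiv.swap a b p) := fun p => by rw [hZ]; rfl
  have hZa : Z.entry a = X.entry b := by rw [hentry, Equiv.swap_apply_left]
  have hZb : Z.entry b = X.entry a := by rw [hentry, Equiv.swap_apply_right]
  have hRa : Z.rank a = X.rank b := by rw [hrank, Equiv.swap_apply_left]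
  have hRb : Z.rank b = X.rank a := by rw [hrank, Equiv.swap_apply_right]
  have hother : ∀ q, q ≠ a → q ≠ b → Z.entry q = X.entry q ∧ Z.rank q = X.rank q := by
    intro q h1 h2
    rw [hentry, hrank, Equiv.swap_apply_of_ne_of_ne h1 h2]
    exact ⟨rfl, rfl⟩
  have ha1 := X.entry_pos a
  -- On a common pole of `X`, the two boxes would share a pole of `Z` with the larger entry higher
  -- up.
  have hrab : X.rank a ≠ X.rank b := by
    intro h1
    have := Z.row_add_le h (p := b) (q := a) (i := X.entry b - X.entry a) (by omega)
      (by rw [hRa, hRb, h1])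
    omega
  have hcases : ∀ {c m u}, X.deformCoeff a b t c m u ≠ 0 →
      X.poleCoeff k c m u ≠ 0 ∨ (c = a.1.2 ∧ m = X.rank b ∧ u + 1 = X.entry b) := by
    intro c m u h1
    by_contra h2
    push Not at h2
    refine h1 ?_
    rw [LRTableau.deformCoeff, h2.1, if_neg (fun h3 => h2.2 h3.1 h3.2.1 h3.2.2), mul_zero, add_zero]
  have hextra : ∀ {c m u}, ¬ (c = a.1.2 ∧ m = X.rank b ∧ u + 1 = X.entry b) →
      X.deformCoeff a b t c m u = X.poleCoeff k c m u := fun h1 => by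
    rw [LRTableau.deformCoeff, if_neg h1, mul_zero, add_zero]
  have hpole_a : ∀ u, X.poleCoeff k a.1.2 (X.rank b) u = 0 := by
    intro u
    by_contra h1
    obtain ⟨q, h2, -, h3⟩ := LRTableau.poleCoeff_ne_zero_iff.1 h1
    rw [h.col_injective h2] at h3
    exact hrab h3
  have hK : ∀ c m u, X.deformCoeff a b t c m u ≠ 0 →
      (m, u) ∈ α.transpose ∧ (c, u) ∈ β.transpose := by
    intro c m u hne
    rcases hcases hne with h1 | ⟨rfl, rfl, h1⟩
    · exact X.mem_of_poleCoeff_ne_zero h h1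
    · rw [YoungDiagram.mem_transpose, YoungDiagram.mem_transpose]
      have h2 := X.mem_of_rank b
      rw [← h1, Nat.add_sub_cancel] at h2
      have h3 := Z.entry_le_row h a
      exact ⟨h2, β.up_left_mem (show u ≤ a.1.1 from by unfold cellRow at h3; omega) le_rfl
        (Finset.mem_sdiff.1 a.2).1⟩
  refine mem_stratum_of_exists h Z _ (toeplitz_comp_nilOp hK) fun p => ?_
  have hmem : ∀ q : SkewCell β γ, (X.rank q, X.entry q - 1) ∈ α.transpose := fun q =>
    YoungDiagram.mem_transpose.2 (X.mem_of_rank q)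
  have hp := Z.entry_pos p
  suffices hs : ∃ y ∈ LinearMap.range (nilOp k α.transpose ^ (Z.entry p - 1)),
      (∀ c r, coeff (toeplitz α.transpose β.transpose (X.deformCoeff a b t) y) c r ≠ 0 →
        ∃ q : SkewCell β γ, q.1.2 = c ∧ cellRow p + r ≤ cellRow q) ∧
      coeff (toeplitz α.transpose β.transpose (X.deformCoeff a b t) y) p.1.2 0 ≠ 0 by
    obtain ⟨y, hy, h1, h2⟩ := hs
    refine ⟨y, hy, fun c r hc => ?_, h2⟩
    obtain ⟨q, rfl, hq⟩ := h1 c r hc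
    exact h.shifted_mem hq
  rcases eq_or_ne p b with rfl | hpb
  · -- the box `b`: eliminate the leading term of the pole through `a`
    refine ⟨blockVec k _ (X.rank a) (X.entry a - 1) - t⁻¹ • blockVec k _ (X.rank p) (X.entry p - 1),
      Submodule.sub_mem _ (blockVec_mem_range (hmem a) (by omega))
        (Submodule.smul_mem _ _ (blockVec_mem_range (hmem p) (by omega))), fun c r hc => ?_, ?_⟩
    · rw [map_sub, map_smul, coeff_sub, coeff_smul, coeff_toeplitz_blockVec hK (hmem a),
        coeff_toeplitz_blockVec hK (hmem p), hextra (fun h1 => hrab h1.2.1)] at hc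
      by_cases hca : c = a.1.2
      · refine absurd ?_ hc
        subst hca
        rw [LRTableau.deformCoeff, hpole_a, zero_add]
        rcases Nat.eq_zero_or_pos r with rfl | h0
        · rw [LRTableau.poleCoeff_of_ne_zero (LRTableau.poleCoeff_ne_zero_iff.2
            ⟨a, rfl, by omega, rfl⟩), if_pos ⟨rfl, rfl, by omega⟩, mul_one, inv_mul_cancel₀ ht,
            sub_self]
        · rw [if_neg (by omega), mul_zero, mul_zero, sub_zero]
          by_contra h1
          obtain ⟨q, h2, h3, -⟩ := LRTableau.poleCoeff_ne_zero_iff.1 h1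
          rw [h.col_injective h2] at h3
          omega
      · rw [hextra (fun h1 => hca h1.1)] at hc
        by_cases h1 : X.poleCoeff k c (X.rank a) (r + (X.entry a - 1)) = 0
        · rw [h1, zero_sub, neg_ne_zero] at hc
          obtain ⟨q, h2, h3, h4⟩ := LRTableau.poleCoeff_ne_zero_iff.1 (right_ne_zero_of_mul hc)
          exact ⟨q, h2, X.row_add_le h (by omega) h4.symm⟩
        · obtain ⟨q, h2, h3, h4⟩ := LRTableau.poleCoeff_ne_zero_iff.1 h1
          have hqa : q ≠ a := fun h5 => hca (by rw [← h2, h5])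
          have hqb : q ≠ p := fun h5 => hrab (by rw [← h4, h5])
          obtain ⟨h5, h6⟩ := hother q hqa hqb
          exact ⟨q, h2, Z.row_add_le h (by omega) (by rw [h6, h4, hRb])⟩
    · have hne : p.1.2 ≠ a.1.2 := fun h1 => by
        rw [h.col_injective h1] at hr
        exact lt_irrefl _ hr
      rw [map_sub, map_smul, coeff_sub, coeff_smul, coeff_toeplitz_blockVec hK (hmem a),
        coeff_toeplitz_blockVec hK (hmem p), hextra (fun h1 => hne h1.1),
        hextra (fun h1 => hne h1.1)]
      have h1 : X.poleCoeff k p.1.2 (X.rank a) (0 + (X.entry a - 1)) = 0 := by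
        by_contra h1
        obtain ⟨q, h2, -, h3⟩ := LRTableau.poleCoeff_ne_zero_iff.1 h1
        rw [h.col_injective h2] at h3
        exact hrab h3.symm
      rw [h1, zero_sub, neg_ne_zero]
      exact mul_ne_zero (inv_ne_zero ht)
        (LRTableau.poleCoeff_ne_zero_iff.2 ⟨p, rfl, by omega, rfl⟩)
  -- The box `a`: the leading coefficient is `t`, and the old leading term in column `b` is now
  -- subordinate.
  rcases eq_or_ne p a with rfl | hpa
  · refine ⟨_, blockVec_mem_range (hmem b) (by omega), fun c r hc => ?_, ?_⟩
    · rw [coeff_toeplitz_blockVec hK (hmem b)] at hc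
      rcases hcases hc with h1 | ⟨h1, -, h2⟩
      · obtain ⟨q, h2, h3, h4⟩ := LRTableau.poleCoeff_ne_zero_iff.1 h1
        refine ⟨q, h2, ?_⟩
        have hqa : q ≠ p := fun h5 => hrab (by rw [← h4, h5])
        rcases eq_or_ne q b with rfl | hqb
        · omega
        · obtain ⟨h5, h6⟩ := hother q hqa hqb
          exact Z.row_add_le h (by omega) (by rw [h6, h4, hRa])
      · exact ⟨p, h1.symm, by omega⟩
    · rw [coeff_toeplitz_blockVec hK (hmem b), LRTableau.deformCoeff, hpole_a,
        if_pos ⟨rfl, rfl, by omega⟩, mul_one, zero_add]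
      exact ht
  -- The vector used for `X` still works: the extra term appears only if `p` is on the pole of `b`,
  -- and then `a` is a lower box of the same pole of `Z`.
  · obtain ⟨h1, h2⟩ := hother p hpa hpb
    refine ⟨_, blockVec_mem_range (hmem p) (by omega), fun c r hc => ?_, ?_⟩
    · rw [coeff_toeplitz_blockVec hK (hmem p)] at hc
      rcases hcases hc with h3 | ⟨h3, h4, h5⟩
      · obtain ⟨q, h4, h5, h6⟩ := LRTableau.poleCoeff_ne_zero_iff.1 h3
        exact ⟨q, h4, X.row_add_le h (by omega) h6.symm⟩
      · exact ⟨a, h3.symm, Z.row_add_le h (by omega) (by rw [h2, hRa, h4])⟩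
    · rw [coeff_toeplitz_blockVec hK (hmem p), hextra fun h3 => hpa (h.col_injective h3.1),
        LRTableau.poleCoeff_ne_zero_iff]
      exact ⟨p, rfl, by omega, rfl⟩

lemma subset_zariskiClosure {μ ν : YoungDiagram} (S : Set (NilSpace k μ →ₗ[k] NilSpace k ν)) :
    S ⊆ zariskiClosure k S :=
  fun φ hφ => MvPolynomial.zeroLocus_vanishingIdeal_le _ ⟨φ, hφ, rfl⟩

theorem boundaryRel_refl (h : IsRookStrip β γ) (X : LRTableau α β γ) : BoundaryRel k X X :=
  ⟨_, toeplitz_poleCoeff_mem_stratum h X,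
    subset_zariskiClosure _ (toeplitz_poleCoeff_mem_stratum h X)⟩

theorem SimpleMove.boundaryRel [Infinite k] (h : IsRookStrip β γ) {X Z : LRTableau α β γ}
    (hm : SimpleMove X Z) : BoundaryRel k Z X := by
  obtain ⟨a, b, h1, h2, h3, h4⟩ := hm
  refine ⟨_, toeplitz_poleCoeff_mem_stratum h X, ?_⟩
  have h0 : X.poleCoeff k = X.deformCoeff a b (0 : k) := by
    funext c m u
    rw [LRTableau.deformCoeff, zero_mul, add_zero]
  rw [h0]
  refine mem_zariskiClosure_of_line (fun t => toeplitz _ _ (X.deformCoeff a b t))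
    (fun p => ?_) fun t ht => toeplitz_deformCoeff_mem_stratum h h1 h2 h3 h4 ht
  simp only [coords_toeplitz, LRTableau.deformCoeff]
  exact ⟨_, _, fun t => rfl⟩

theorem DomLE.boundaryLE [Infinite k] (h : IsRookStrip β γ) {X Z : LRTableau α β γ}
    (hd : DomLE Z X) : BoundaryLE k Z X := by
  have hm := hd.exists_simpleMoves h
  clear hd
  induction hm with
  -- The transitive closure is not reflexive by definition; the empty chain needs a nonempty
  -- stratum.
  | refl => exact Relation.TransGen.single (boundaryRel_refl h X)
  | tail _ h2 ih => exact Relation.TransGen.head (h2.boundaryRel h) ih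

end Degeneration

/-! ### Rank semicontinuity: boundary implies dominance. -/

section Semicontinuity

variable {k : Type*} [Field k] {μ ν : YoungDiagram}

/-- The quotient by `T^j B + W` is the cokernel of `T^j` on `N_{ν'}`; its dimension equals that of
the kernel and counts the boxes in the first `j` rows of `ν`. -/
lemma finrank_range_pow_sup {W : Submodule k (NilSpace k μ)} (h : QuotientIso k μ W ν.transpose)
    (j : ℕ) : Module.finrank k ↥(LinearMap.range (nilOp k μ ^ j) ⊔ W)
      + ∑ i ∈ Finset.range j, ν.rowLen i = μ.card := by
  obtain ⟨e, he⟩ := h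
  set S := nilOp k ν.transpose with hS
  let π : NilSpace k μ →ₗ[k] NilSpace k ν.transpose := e.toLinearMap ∘ₗ W.mkQ
  have hπ : Function.Surjective π := e.surjective.comp W.mkQ_surjective
  have hπker : LinearMap.ker π = W := by
    rw [LinearEquiv.ker_comp, Submodule.ker_mkQ]
  have hpow : ∀ s v, π ((nilOp k μ ^ s) v) = (S ^ s) (π v) := by
    intro s
    induction s with
    | zero => intro v; simp
    | succ s ih =>
      intro v
      rw [pow_succ, Module.End.mul_apply, ih, pow_succ, Module.End.mul_apply]
      exact congrArg _ (he v)
  let ρ : NilSpace k μ →ₗ[k] (NilSpace k ν.transpose ⧸ LinearMap.range (S ^ j)) :=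
    (LinearMap.range (S ^ j)).mkQ ∘ₗ π
  have hρ : Function.Surjective ρ := (Submodule.mkQ_surjective _).comp hπ
  have hker : LinearMap.ker ρ = LinearMap.range (nilOp k μ ^ j) ⊔ W := by
    have h1 : LinearMap.range (S ^ j) = (LinearMap.range (nilOp k μ ^ j)).map π := by
      ext x
      constructor
      · rintro ⟨y, rfl⟩
        obtain ⟨v, rfl⟩ := hπ y
        exact ⟨_, ⟨v, rfl⟩, hpow j v⟩
      · rintro ⟨_, ⟨v, rfl⟩, rfl⟩
        exact ⟨π v, (hpow j v).symm⟩
    rw [LinearMap.ker_comp, Submodule.ker_mkQ, h1, Submodule.comap_map_eq, hπker]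
  have h1 := LinearMap.finrank_range_add_finrank_ker ρ
  rw [LinearMap.range_eq_top.2 hρ, finrank_top, hker, finrank_nilSpace] at h1
  have h2 := (LinearMap.range (S ^ j)).finrank_quotient_add_finrank
  have h3 := LinearMap.finrank_range_add_finrank_ker (S ^ j)
  rw [hS, finrank_ker_nilOp_transpose_pow, ← hS] at h3
  omega

/-- The map `(x, a) ↦ T ^ j x + T ^ l (φ a)`. -/
def powSum (φ : NilSpace k μ →ₗ[k] NilSpace k ν) (j l : ℕ) :
    (NilSpace k ν × NilSpace k μ) →ₗ[k] NilSpace k ν :=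
  (nilOp k ν ^ j).coprod ((nilOp k ν ^ l) ∘ₗ φ)

lemma finrank_range_powSum (X : LRTableau α β γ)
    {φ : NilSpace k α.transpose →ₗ[k] NilSpace k β.transpose} (hφ : φ ∈ stratum k X) (j l : ℕ) :
    Module.finrank k (LinearMap.range (powSum φ j l))
      + ∑ i ∈ Finset.range j, (X.region l).rowLen i = β.card := by
  have h1 := finrank_range_pow_sup (hφ.2 l) j
  rw [powSum, LinearMap.range_coprod, LinearMap.range_comp, h1, card_transpose]

lemma exists_mvPolynomial_apply (w : NilSpace k μ) (f : NilSpace k ν →ₗ[k] k) :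
    ∃ P : MvPolynomial (ν.cells × μ.cells) k, ∀ φ : NilSpace k μ →ₗ[k] NilSpace k ν,
      MvPolynomial.aeval (coords k φ) P = f (φ w) := by
  refine ⟨∑ p, ∑ q, MvPolynomial.C (f (Pi.single p 1) * w q) * MvPolynomial.X (p, q),
    fun φ => ?_⟩
  have h1 : φ w = ∑ p, (∑ q, LinearMap.toMatrix' φ p q * w q) • (Pi.single p 1 : NilSpace k ν) := by
    conv_lhs => rw [← LinearMap.toMatrix'_mulVec φ w]
    funext p
    simp [Matrix.mulVec, dotProduct, Finset.sum_apply, Pi.single_apply]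
  rw [h1]
  simp only [map_sum, map_mul, MvPolynomial.aeval_C, MvPolynomial.aeval_X, Algebra.algebraMap_self,
    RingHom.id_apply, map_smul, smul_eq_mul, Finset.sum_mul, coords]
  refine Finset.sum_congr rfl fun p _ => Finset.sum_congr rfl fun q _ => ?_
  ring

/-- The rank of `powSum` is lower semicontinuous. -/
theorem exists_finrank_range_powSum_le {S : Set (NilSpace k μ →ₗ[k] NilSpace k ν)}
    {φ : NilSpace k μ →ₗ[k] NilSpace k ν} (hφ : φ ∈ zariskiClosure k S) (j l : ℕ) :
    ∃ ψ ∈ S, Module.finrank k (LinearMap.range (powSum φ j l))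
      ≤ Module.finrank k (LinearMap.range (powSum ψ j l)) := by
  classical
  set R := LinearMap.range (powSum φ j l) with hR
  set n := Module.finrank k R with hn
  -- A nonvanishing minor at `φ`: preimages `w` of a basis of the range and dual functionals `f`
  -- give the identity matrix. With `w` and `f` fixed, the determinant `D` is polynomial in the
  -- coordinates of the homomorphism.
  let b : Module.Basis (Fin n) k R := Module.finBasis k R
  obtain ⟨pr, hpr⟩ := R.subtype.exists_leftInverse_of_injective (Submodule.ker_subtype R)
  have hex : ∀ y : Fin n, ∃ w, powSum φ j l w = b y := fun y => (b y).2
  choose w hw using hex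
  let f : Fin n → NilSpace k ν →ₗ[k] k := fun x => b.coord x ∘ₗ pr
  have hfw : ∀ x y, f x (powSum φ j l (w y)) = if y = x then 1 else 0 := by
    intro x y
    have h1 : pr (b y : NilSpace k ν) = b y := LinearMap.congr_fun hpr (b y)
    simp only [f, LinearMap.comp_apply, hw, h1, Module.Basis.coord_apply, Module.Basis.repr_self,
      Finsupp.single_apply]
  have hP : ∀ x y, ∃ P : MvPolynomial (ν.cells × μ.cells) k,
      ∀ ψ : NilSpace k μ →ₗ[k] NilSpace k ν,
        MvPolynomial.aeval (coords k ψ) P = f x (powSum ψ j l (w y)) := by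
    intro x y
    obtain ⟨P, hP⟩ := exists_mvPolynomial_apply (ν := ν) (w y).2 (f x ∘ₗ nilOp k ν ^ l)
    refine ⟨MvPolynomial.C (f x ((nilOp k ν ^ j) (w y).1)) + P, fun ψ => ?_⟩
    rw [map_add, hP, MvPolynomial.aeval_C]
    simp [powSum]
  choose P hP using hP
  let D := (Matrix.of P).det
  have hD : ∀ ψ, MvPolynomial.aeval (coords k ψ) D
      = (Matrix.of fun x y => f x (powSum ψ j l (w y))).det := by
    intro ψ
    rw [AlgHom.map_det]
    congr 1
    ext x y
    exact hP x y ψ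
  have hDφ : MvPolynomial.aeval (coords k φ) D ≠ 0 := by
    rw [hD]
    have : (Matrix.of fun x y => f x (powSum φ j l (w y))) = 1 := by
      ext x y
      rw [Matrix.of_apply, hfw, Matrix.one_apply]
      simp only [eq_comm]
    rw [this, Matrix.det_one]
    exact one_ne_zero
  obtain ⟨ψ, hψ, hDψ⟩ : ∃ ψ ∈ S, MvPolynomial.aeval (coords k ψ) D ≠ 0 := by
    by_contra hc
    push Not at hc
    refine hDφ (MvPolynomial.mem_zeroLocus_iff.1 hφ D ?_)
    rw [MvPolynomial.mem_vanishingIdeal_iff]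
    rintro _ ⟨ψ, hψ, rfl⟩
    exact hc ψ hψ
  refine ⟨ψ, hψ, ?_⟩
  rw [hD] at hDψ
  let F : NilSpace k ν →ₗ[k] (Fin n → k) := LinearMap.pi f
  let G : (Fin n → k) →ₗ[k] (NilSpace k ν × NilSpace k μ) := Fintype.linearCombination k w
  have hFG : (F ∘ₗ powSum ψ j l ∘ₗ G)
      = Matrix.toLin' (Matrix.of fun x y => f x (powSum ψ j l (w y))) := by
    refine LinearMap.pi_ext' fun y => LinearMap.ext_ring ?_
    funext x
    simp [F, G, Fintype.linearCombination_apply_single, Matrix.col]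
  have hsurj : Function.Surjective (F ∘ₗ powSum ψ j l ∘ₗ G) := by
    rw [hFG]
    exact Matrix.mulVec_surjective_iff_isUnit.2 ((Matrix.isUnit_iff_isUnit_det _).2 hDψ.isUnit)
  have htop : (LinearMap.range (powSum ψ j l)).map F = ⊤ := by
    refine eq_top_iff.2 fun x _ => ?_
    obtain ⟨v, rfl⟩ := hsurj x
    exact ⟨_, ⟨G v, rfl⟩, rfl⟩
  have h1 := Submodule.finrank_map_le F (LinearMap.range (powSum ψ j l))
  rw [htop, finrank_top, Module.finrank_fin_fun] at h1
  exact h1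

/-- Some `ψ` with tableau `Z` has rank at least that of `φ`, and partial sums are complementary to
ranks. -/
theorem BoundaryRel.domLE {X Z : LRTableau α β γ} (h : BoundaryRel k Z X) : DomLE Z X := by
  obtain ⟨φ, hX, hZ⟩ := h
  intro l j
  obtain ⟨ψ, hψ, hle⟩ := exists_finrank_range_powSum_le hZ j l
  have h1 := finrank_range_powSum X hX j l
  have h2 := finrank_range_powSum Z hψ j l
  omega

theorem BoundaryLE.domLE {X Z : LRTableau α β γ} (h : BoundaryLE k Z X) : DomLE Z X := by
  unfold BoundaryLE at h
  induction h with
  | single h => exact h.domLE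
  | tail _ h2 ih => exact ih.trans h2.domLE

end Semicontinuity

end LRTab

theorem mainTheorem2 (k : Type*) [Field k] [IsAlgClosed k] (α β γ : YoungDiagram)
    (hstrip : LRTab.IsRookStrip β γ) (X Z : LRTab.LRTableau α β γ) :
    List.TFAE [LRTab.BoxLE Z X, LRTab.BoundaryLE k Z X, LRTab.DomLE Z X] := by
  have : Infinite k := inferInstance
  tfae_have 1 → 3 := LRTab.BoxLE.domLE hstrip
  tfae_have 2 → 3 := LRTab.BoundaryLE.domLE
  tfae_have 3 → 2 := LRTab.DomLE.boundaryLE hstrip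
  tfae_have 3 → 1 := fun h =>
    Relation.ReflTransGen.mono (fun _ _ => LRTab.SimpleMove.boxMove) _ _ (h.exists_simpleMoves hstrip)
  tfae_finish
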